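/- Let $(\mathcal X_i,q_i,(\eta_{i,j})_{j\ge1})$, $i\ge 1$, be i.i.d. copies of $(\mathcal X,q,(\eta_j)_{j\ge1})$, where $\mathcal X$ is standard Gaussian, $q$ is uniform on $(0,1)$, given $q$ the $\eta_j$ are i.i.d. Bernoulli with parameter $q$, and $\mathcal X$ is independent of $(q,(\eta_j)_j)$. Put $\tau_{i,j}=\sum_{k=1}^j\eta_{i,k}$, $$\mathcal X_{i,j}=\frac{\mathcal X_i}{q_i^{1/2}}\Big((-1)^{\tau_{i,j}+1}\eta_{i,j}-\mathbb E\big[(-1)^{\tau_{i,j}+1}\eta_{i,j}\mid q_i\big]\Big)$$ and, for positive integers $m_n$ (it is enough that they are positive for all large $n$), $$\widehat S_{n,j}=\frac1{\sqrt{m_n}}\sum_{i=1}^{m_n}\sum_{k=1}^j\mathcal X_{i,k}=\frac1{\sqrt{m_n}}\sum_{i=1}^{m_n}\frac{\mathcal X_i}{q_i^{1/2}}\Big(\mathbf 1_{\{\tau_{i,j}\text{ odd}\}}-\mathbb P(\tau_{i,j}\text{ odd}\mid q_i)\Big)\quad\text{a.s.}$$ For $\delta>0$ let $\mathcal F_\delta=\{f\in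 L^\infty([0,\infty)):\int_1^\infty s^\delta|f(s)|\,ds<\infty\}$, and for $f\in\mathcal F_\delta$ let $$G_n(f)=2\sum_{j=1}^\infty \widehat S_{n,j}\int_{(j-1)/n}^{j/n}f(x)\,dx .$$ Let $N'$ be a standard Poisson process on a probability space $(\Omega',\mathbb P')$, let $M$ be a Gaussian random measure on $(0,\infty)\times\Omega'$ with control measure $\mu(dr,d\omega')=2r^{-1}dr\,\mathbb P'(d\omega')$, normalized so that $\int h\,dM$, $h\in L^2(\mu)$, are jointly centered Gaussian with $\mathrm{Cov}(\int h\,dM,\int k\,dM)=2\int hk\,d\mu$, and let $$G(f)=\int_{(0,\infty)\times\Omega'}\int_0^\infty\big(\mathbf 1_{\{N'(rt)\text{ odd}\}}-\mathbb P'(N'(rt)\text{ odd})\big)f(t)\,dt\,M(dr,d\omega').$$ **Theorem.** Assume $m_n/n\to\infty$ and $\delta>0$. Then for all $f\in\mathcal F_\delta$ the series $G_n(f)$ converges absolutely almost surely, the stochastic integral $G(f)$ is well defined (its integrand is in $L^2(\mu)$), and $\{G(f)\}_{f\in\mathcal F_\delta}$ is a centered Gaussian process with $$\mathrm{Cov}(G(f),G(g))=\int_0^\infty\!\!\int_0^\infty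 f(s)g(t)\log\frac{s+t}{|s-t|}\,ds\,dt\qquad(f,g\in\mathcal F_\delta),$$ the double integral being absolutely convergent. Moreover, for all $f\in\mathcal F_\delta$, $$\lim_{n\to\infty}\mathbb E\exp(iG_n(f))=\mathbb E\exp(iG(f))=\exp\Big(-\tfrac12\mathrm{Cov}(G(f),G(f))\Big),$$ and the finite-dimensional distributions of $\{G_n(f)\}_{f\in\mathcal F_\delta}$ converge weakly to those of $\{G(f)\}_{f\in\mathcal F_\delta}$ as $n\to\infty$. -/

import Mathlib

open MeasureTheory ProbabilityTheory Filter Topology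
open scoped NNReal ENNReal

noncomputable section

/-- The class of test functions: (representatives of) `f ∈ L^∞([0,∞))` with
`∫_1^∞ s^δ |f(s)| ds < ∞`. Values of `f` on the negative half-line play no role. -/
def TestClass (δ : ℝ) : Set (ℝ → ℝ) :=
  {f | MemLp f ∞ (volume.restrict (Set.Ici 0)) ∧
    IntegrableOn (fun s : ℝ => s ^ δ * |f s|) (Set.Ici 1) volume}

/-! ### The aggregated model

Sequences `(η_j)_{j ≥ 1}` are indexed from `0`: `η k` stands for `η_{k+1}`. -/

section Model

variable {Ω : Type*} [MeasurableSpace Ω]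

/-- Given `q`, the variables `η 0, η 1, …` are conditionally i.i.d. Bernoulli with parameter `q`:
for every finite pattern, `P(η_k = ε_k for k ∈ s | q) = ∏_{k ∈ s} q^{ε_k} (1-q)^{1-ε_k}` a.s. -/
def IsCondIIDBernoulli (q : Ω → ℝ) (η : ℕ → Ω → Bool) (P : Measure Ω) : Prop :=
  ∀ (s : Finset ℕ) (ε : ℕ → Bool),
    P[Set.indicator {ω | ∀ k ∈ s, η k ω = ε k} (fun _ => (1 : ℝ)) |
        MeasurableSpace.comap q inferInstance]
      =ᵐ[P] fun ω => ∏ k ∈ s, if ε k then q ω else 1 - q ω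

/-- The i.i.d. layers `(𝒳_i, q_i, (η_{i,j})_j)`: `𝒳_i` is standard Gaussian, `q_i` is uniform
on `(0,1)`, given `q_i` the `η_{i,j}` are i.i.d. Bernoulli with parameter `q_i`, and `𝒳_i` is
independent of `(q_i, (η_{i,j})_j)`. -/
structure IsLayerModel (X : ℕ → Ω → ℝ) (q : ℕ → Ω → ℝ) (η : ℕ → ℕ → Ω → Bool)
    (P : Measure Ω) : Prop where
  measurable_X : ∀ i, Measurable (X i)
  measurable_q : ∀ i, Measurable (q i)
  measurable_η : ∀ i k, Measurable (η i k)
  gaussian_X : ∀ i, HasLaw (X i) (gaussianReal 0 1) P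
  uniform_q : ∀ i, pdf.IsUniform (q i) (Set.Ioo 0 1) P volume
  bernoulli_η : ∀ i, IsCondIIDBernoulli (q i) (η i) P
  indep_layer : ∀ i, IndepFun (X i) (fun ω => (q i ω, fun k => η i k ω)) P
  indep : iIndepFun (fun i ω => (X i ω, q i ω, fun k => η i k ω)) P

/-- `τ_j = η_1 + ⋯ + η_j`, for one layer. -/
def bernoulliCount (η : ℕ → Ω → Bool) (j : ℕ) (ω : Ω) : ℕ :=
  ∑ k ∈ Finset.range j, (η k ω).toNat

/-- The signed variable `(-1)^{τ_{k+1}+1} η_{k+1}`, for one layer. -/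
def signedStep (η : ℕ → Ω → Bool) (k : ℕ) (ω : Ω) : ℝ :=
  (-1) ^ (bernoulliCount η (k + 1) ω + 1) * ((η k ω).toNat : ℝ)

/-- The `(k+1)`-st element of a layer:
`(𝒳 / q^{1/2}) ((-1)^{τ_{k+1}+1} η_{k+1} - E[(-1)^{τ_{k+1}+1} η_{k+1} | q])`. -/
def layerStep (X q : Ω → ℝ) (η : ℕ → Ω → Bool) (P : Measure Ω) (k : ℕ) (ω : Ω) : ℝ :=
  X ω / Real.sqrt (q ω) *
    (signedStep η k ω - (P[signedStep η k | MeasurableSpace.comap q inferInstance]) ω)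

/-- The partial sum `Ŝ_{n,j} = m^{-1/2} ∑_{i=1}^{m} ∑_{k=1}^{j} 𝒳_{i,k}`, where `m = m_n`. -/
def partialSum (X q : ℕ → Ω → ℝ) (η : ℕ → ℕ → Ω → Bool) (P : Measure Ω) (m j : ℕ) (ω : Ω) : ℝ :=
  (Real.sqrt m)⁻¹ *
    ∑ i ∈ Finset.range m, ∑ k ∈ Finset.range j, layerStep (X i) (q i) (η i) P k ω

/-- The term `Ŝ_{n,j+1} ∫_{j/n}^{(j+1)/n} f(x) dx` of the series defining `G_n(f)`, `m = m_n`. -/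
def aggregatedTerm (X q : ℕ → Ω → ℝ) (η : ℕ → ℕ → Ω → Bool) (P : Measure Ω) (m n : ℕ)
    (f : ℝ → ℝ) (j : ℕ) (ω : Ω) : ℝ :=
  partialSum X q η P m (j + 1) ω * ∫ x in ((j : ℝ) / n)..(((j : ℝ) + 1) / n), f x

/-- `G_n(f) = 2 ∑_{j ≥ 1} Ŝ_{n,j} ∫_{(j-1)/n}^{j/n} f(x) dx`, with `m = m_n`. -/
def aggregated (X q : ℕ → Ω → ℝ) (η : ℕ → ℕ → Ω → Bool) (P : Measure Ω) (m n : ℕ)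
    (f : ℝ → ℝ) (ω : Ω) : ℝ :=
  2 * ∑' j, aggregatedTerm X q η P m n f j ω

end Model

/-! ### The limit process -/

/-- `N` is a standard (rate one) Poisson process. -/
structure IsStandardPoisson {Ω' : Type*} [MeasurableSpace Ω'] (N : ℝ≥0 → Ω' → ℕ)
    (P' : Measure Ω') : Prop where
  measurable : ∀ t, Measurable (N t)
  zero : ∀ ω, N 0 ω = 0
  mono : ∀ ω, Monotone fun t => N t ω
  right_cont : ∀ ω t, ContinuousWithinAt (fun u => N u ω) (Set.Ici t) t
  indep : HasIndepIncrements N P'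
  law : ∀ s t, s ≤ t → HasLaw (fun ω => N t ω - N s ω) (poissonMeasure (t - s)) P'

/-- `I` is the stochastic integral `f ↦ ∫ f dM` over square-integrable `f`, where `M` is a Gaussian
random measure with control measure `μ`; here `M A` is `I` of the indicator of `A`. It is a centered
Gaussian family with `Cov(∫ f dM, ∫ g dM) = 2 ∫ f g dμ` (the factor `2` is the normalization
`E exp(iθ ∫ f dM) = exp(-θ² ∫ f² dμ)`). -/
structure IsGaussianIntegral {E Ω : Type*} [MeasurableSpace E] [MeasurableSpace Ω]
    (I : (E → ℝ) → Ω → ℝ) (μ : Measure E) (Q : Measure Ω) : Prop where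
  gaussian : IsGaussianProcess (fun f : {f : E → ℝ // MemLp f 2 μ} => I f.1) Q
  centered : ∀ f, MemLp f 2 μ → ∫ ω, I f ω ∂Q = 0
  cov : ∀ f g, MemLp f 2 μ → MemLp g 2 μ → cov[I f, I g; Q] = 2 * ∫ x, f x * g x ∂μ

section Limit

variable {Ω' : Type*} [MeasurableSpace Ω']

/-- The control measure `2 r⁻¹ dr dP'` on `ℝ₊ × Ω'`. -/
def controlMeasure (P' : Measure Ω') : Measure (ℝ × Ω') :=
  ((volume.restrict (Set.Ioi (0 : ℝ))).withDensity fun r => ENNReal.ofReal (2 / r)).prod P'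

/-- The event that `N(x)` is odd, for `x ≥ 0`. -/
def oddEvent (N : ℝ≥0 → Ω' → ℕ) (x : ℝ) : Set Ω' := {ω | Odd (N x.toNNReal ω)}

/-- The integrand `(r, ω') ↦ ∫_0^∞ (1{N(rt) is odd} - P'(N(rt) is odd)) f(t) dt`. -/
def oddKernel (N : ℝ≥0 → Ω' → ℕ) (P' : Measure Ω') (f : ℝ → ℝ) (z : ℝ × Ω') : ℝ :=
  ∫ t in Set.Ioi (0 : ℝ),
    ((oddEvent N (z.1 * t)).indicator (fun _ => (1 : ℝ)) z.2 - P'.real (oddEvent N (z.1 * t))) * f t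

/-- `G(f) = ∫ ∫_0^∞ (1{N(rt) is odd} - P'(N(rt) is odd)) f(t) dt M(dr, dω')`. -/
def limitProcess {Ω : Type*} (N : ℝ≥0 → Ω' → ℕ) (P' : Measure Ω') (I : (ℝ × Ω' → ℝ) → Ω → ℝ)
    (f : ℝ → ℝ) : Ω → ℝ :=
  I (oddKernel N P' f)

end Limit

/-- The function `(s,t) ↦ f(s) g(t) log((s+t)/|s-t|)`. -/
def logIntegrand (f g : ℝ → ℝ) (z : ℝ × ℝ) : ℝ :=
  f z.1 * g z.2 * Real.log ((z.1 + z.2) / |z.1 - z.2|)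

/-- Lebesgue measure on `(0,∞)²`. -/
def quadrantMeasure : Measure (ℝ × ℝ) :=
  (volume.restrict (Set.Ioi (0 : ℝ))).prod (volume.restrict (Set.Ioi (0 : ℝ)))

end

/-! The step `(-1)^{τ_j+1} η_j` is half the difference of two consecutive signs `(-1)^{τ_{j-1}}` and
`(-1)^{τ_j}`, so a layer telescopes to the centered sign `c_j = E[(-1)^{τ_j} | q] - (-1)^{τ_j}`, up
to the factor `𝒳 / (2 √q)`. The series is then the integral of a step function, and almost surely
`G_n(f) = m^{-1/2} ∑_{i<m} 𝒳_i Y_i` with `Y = q^{-1/2} ∫ c_{⌈nt⌉} f(t) dt`. Since the `𝒳_i` are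
Gaussian and independent of the `Y_i`, the characteristic function of `G_n(f)` is a product of
Laplace transforms `E exp(-Y²/(2m))`, and two facts about `Y` suffice.

Second moment. Given `q = u`, the covariance of `c_j` and `c_k` is `(1-2u)^{|j-k|} - (1-2u)^{j+k}`.
Integrated against `du/u` it becomes a finite sum of reciprocals of odd integers, trapped between
explicit logarithms (`le_covKernel`, `covKernel_le`). At `j = ⌈ns⌉`, `k = ⌈nt⌉` these converge to
`log((s+t)/|s-t|)` under a majorant that does not depend on `n`, so `E Y²` converges to the double
integral (`tendsto_aggregatedVariance`).

Linearization. With `x = Y²/(2m)`, one has `|x - (1 - e^{-x})| ≤ x^{1+κ}`, and `E x^{1+κ}` is at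
most a constant times `m⁻¹ (n/m)^κ` (`abs_laplace_sub_le`). Summed over `m` layers the error is of
order `(n/m)^κ`, which vanishes because `m/n → ∞`; the moment condition on `f` is what permits some
`κ > 0`.

On the limit side the parity of a Poisson process has covariance `(e^{-2r|s-t|} - e^{-2r(s+t)})/4`,
and integrating over `dr/r` gives the same logarithm by Frullani's formula
(`two_mul_integral_oddKernel`). Linearity in `f` and the Cramér–Wold device turn convergence of
characteristic functions into convergence of finite-dimensional distributions. -/

noncomputable section

/-- Lebesgue measure on the open half-line `(0,∞)`. -/
abbrev halfLine : Measure ℝ := volume.restrict (Set.Ioi (0 : ℝ))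

/-! ### Integrability of test functions -/

section TestFunctions

variable {δ : ℝ} {f g : ℝ → ℝ}

theorem TestClass.aestronglyMeasurable (hf : f ∈ TestClass δ) :
    AEStronglyMeasurable f halfLine :=
  hf.1.1.mono_measure (Measure.restrict_mono Set.Ioi_subset_Ici_self le_rfl)

theorem TestClass.exists_bound (hf : f ∈ TestClass δ) :
    ∃ C : ℝ, 0 ≤ C ∧ ∀ᵐ t ∂halfLine, |f t| ≤ C := by
  have h : MemLp f ∞ halfLine :=
    hf.1.mono_measure (Measure.restrict_mono Set.Ioi_subset_Ici_self le_rfl)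
  refine ⟨(eLpNorm f ∞ halfLine).toReal, ENNReal.toReal_nonneg, ?_⟩
  have h2 := ae_le_eLpNormEssSup (f := f) (μ := halfLine)
  filter_upwards [h2] with t ht
  rw [← eLpNorm_exponent_top] at ht
  have := (ENNReal.toReal_le_toReal (by simp) h.2.ne).2 ht
  simpa using this

/-- Boundedness of `f` handles `(0,1]`; beyond `1`, `1 + s ≤ 2s` reduces the weight to the moment of
order `δ`. The case `κ = 0` is plain integrability, and small positive `κ` feeds the error bound for
the Laplace transform. -/
theorem TestClass.integrable_weight (hf : f ∈ TestClass δ) {κ : ℝ} (hκ : 0 ≤ κ) (hκδ : κ ≤ δ) :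
    Integrable (fun s => (1 + s) ^ κ * |f s|) halfLine := by
  obtain ⟨C, hC, hb⟩ := TestClass.exists_bound hf
  have hm : AEStronglyMeasurable (fun s => (1 + s) ^ κ * |f s|) halfLine := by
    refine AEStronglyMeasurable.mul ?_ (TestClass.aestronglyMeasurable hf).norm
    exact (Measurable.pow_const (by fun_prop) κ).aestronglyMeasurable
  have hU : Set.Ioi (0 : ℝ) = Set.Ioc 0 1 ∪ Set.Ioi 1 := by
    rw [Set.Ioc_union_Ioi_eq_Ioi zero_le_one]
  have h1 : IntegrableOn (fun s => (1 + s) ^ κ * |f s|) (Set.Ioc 0 1) volume := by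
    refine Integrable.mono' (integrable_const (2 ^ κ * C))
      (hm.mono_set Set.Ioc_subset_Ioi_self) ?_
    have hb' : ∀ᵐ t ∂(volume.restrict (Set.Ioc (0 : ℝ) 1)), |f t| ≤ C :=
      ae_mono (Measure.restrict_mono Set.Ioc_subset_Ioi_self le_rfl) hb
    filter_upwards [hb', ae_restrict_mem measurableSet_Ioc] with t ht htm
    have h0 : (0 : ℝ) ≤ 1 + t := by linarith [htm.1]
    rw [Real.norm_eq_abs, abs_mul, abs_abs, abs_of_nonneg (Real.rpow_nonneg h0 κ)]
    gcongr
    linarith [htm.2]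
  have h2 : IntegrableOn (fun s => (1 + s) ^ κ * |f s|) (Set.Ioi 1) volume := by
    have h3 := (hf.2.mono_set Set.Ioi_subset_Ici_self).const_mul ((2 : ℝ) ^ κ)
    refine Integrable.mono' h3
      (hm.mono_measure (Measure.restrict_mono (Set.Ioi_subset_Ioi zero_le_one) le_rfl)) ?_
    filter_upwards [ae_restrict_mem measurableSet_Ioi] with t (ht : (1 : ℝ) < t)
    have h0 : (0 : ℝ) ≤ 1 + t := by linarith
    rw [Real.norm_eq_abs, abs_mul, abs_abs, abs_of_nonneg (Real.rpow_nonneg h0 κ), ← mul_assoc]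
    gcongr
    calc (1 + t) ^ κ ≤ (2 * t) ^ κ := by gcongr; linarith
      _ = 2 ^ κ * t ^ κ := Real.mul_rpow (by norm_num) (by linarith)
      _ ≤ 2 ^ κ * t ^ δ := by gcongr; exact ht.le
  rw [halfLine, hU]
  exact h1.union h2

theorem TestClass.integrable (hδ : 0 ≤ δ) (hf : f ∈ TestClass δ) : Integrable f halfLine := by
  have := TestClass.integrable_weight hf le_rfl hδ
  simp only [Real.rpow_zero, one_mul] at this
  exact (integrable_norm_iff (TestClass.aestronglyMeasurable hf)).1 this

/-- A logarithm is dominated by any positive power, so the moment of order `δ > 0` controls the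
growth of the logarithmic kernel at infinity. -/
theorem TestClass.integrable_log (hδ : 0 < δ) (hf : f ∈ TestClass δ) :
    Integrable (fun s => Real.log (2 + s) * |f s|) halfLine := by
  refine Integrable.mono' ((TestClass.integrable_weight hf hδ.le le_rfl).const_mul (2 ^ δ / δ))
    (AEStronglyMeasurable.mul (Measurable.aestronglyMeasurable (by fun_prop))
      (TestClass.aestronglyMeasurable hf).norm) ?_
  filter_upwards [ae_restrict_mem measurableSet_Ioi] with t (ht : (0 : ℝ) < t)
  rw [Real.norm_eq_abs, abs_mul, abs_abs, abs_of_nonneg (Real.log_nonneg (by linarith)),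
    ← mul_assoc]
  gcongr
  calc Real.log (2 + t) ≤ (2 + t) ^ δ / δ := Real.log_le_rpow_div (by linarith) hδ
    _ ≤ (2 * (1 + t)) ^ δ / δ := by gcongr; linarith
    _ = 2 ^ δ / δ * (1 + t) ^ δ := by
      rw [Real.mul_rpow (by norm_num) (by linarith)]; ring

theorem TestClass.add (hf : f ∈ TestClass δ) (hg : g ∈ TestClass δ) : f + g ∈ TestClass δ := by
  refine ⟨hf.1.add hg.1, ?_⟩
  refine Integrable.mono' (hf.2.add hg.2) ?_ ?_
  · refine AEStronglyMeasurable.mul (Measurable.aestronglyMeasurable (by fun_prop)) ?_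
    exact ((hf.1.1.add hg.1.1).mono_measure
      (Measure.restrict_mono (Set.Ici_subset_Ici.2 zero_le_one) le_rfl)).norm
  · filter_upwards [ae_restrict_mem measurableSet_Ici] with t (ht : (1 : ℝ) ≤ t)
    have h0 : 0 ≤ t ^ δ := Real.rpow_nonneg (by linarith) _
    rw [Real.norm_eq_abs, abs_mul, abs_abs, abs_of_nonneg h0]
    simp only [Pi.add_apply, ← mul_add]
    gcongr
    exact abs_add_le _ _

theorem TestClass.const_mul (c : ℝ) (hf : f ∈ TestClass δ) : (fun t => c * f t) ∈ TestClass δ := by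
  refine ⟨hf.1.const_mul c, ?_⟩
  have := Integrable.const_mul hf.2 |c|
  refine this.congr (ae_of_all _ fun t => ?_)
  simp only [abs_mul]
  ring

theorem TestClass.zero : (fun _ => (0 : ℝ)) ∈ TestClass δ := by
  refine ⟨MemLp.zero', ?_⟩
  simp [IntegrableOn]

theorem TestClass.sum {k : ℕ} {F : Fin k → ℝ → ℝ} (hF : ∀ l, F l ∈ TestClass δ) (c : Fin k → ℝ) :
    (fun t => ∑ l, c l * F l t) ∈ TestClass δ := by
  suffices h : ∀ s : Finset (Fin k), (fun t => ∑ l ∈ s, c l * F l t) ∈ TestClass δ from h _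
  intro s
  induction s using Finset.induction_on with
  | empty => simpa using TestClass.zero
  | insert a s ha ih =>
    have := TestClass.add (TestClass.const_mul (c a) (hF a)) ih
    convert this using 1
    funext t
    rw [Finset.sum_insert ha]
    rfl

end TestFunctions

/-! ### The logarithmic kernel -/

/-- A majorant of the logarithmic kernel and of its discretizations. -/
def logMajorant (z : ℝ × ℝ) : ℝ := 2 + Real.log ((z.1 + z.2 + 3) / |z.1 - z.2|)

theorem measurable_logMajorant : Measurable logMajorant := by
  unfold logMajorant
  fun_prop

theorem ae_quadrant {p : ℝ × ℝ → Prop} (h : ∀ s t, 0 < s → 0 < t → p (s, t)) :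
    ∀ᵐ z ∂quadrantMeasure, p z := by
  rw [quadrantMeasure, Measure.prod_restrict]
  filter_upwards [ae_restrict_mem (measurableSet_Ioi.prod measurableSet_Ioi)] with z hz
  exact h z.1 z.2 hz.1 hz.2

theorem ae_quadrant_ne : ∀ᵐ z ∂quadrantMeasure, z.1 ≠ z.2 := by
  rw [quadrantMeasure]
  refine (Measure.ae_prod_iff_ae_ae ?_).2 ?_
  · exact (measurableSet_eq_fun measurable_fst measurable_snd).compl
  · refine ae_of_all _ fun s => ?_
    have : ∀ᵐ t ∂halfLine, t ≠ s := by
      rw [ae_iff]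
      simp
    filter_upwards [this] with t ht using ht.symm

theorem log_add_div_abs_sub_nonneg {s t : ℝ} (hs : 0 < s) (ht : 0 < t) :
    0 ≤ Real.log ((s + t) / |s - t|) := by
  rcases eq_or_ne s t with rfl | hst
  · simp
  · refine Real.log_nonneg ?_
    rw [one_le_div (abs_pos.2 (sub_ne_zero.2 hst)), abs_le]
    constructor <;> linarith

theorem log_add_div_abs_sub_le {s t : ℝ} (hs : 0 < s) (ht : 0 < t) :
    Real.log ((s + t) / |s - t|) ≤ logMajorant (s, t) := by
  simp only [logMajorant]
  rcases eq_or_ne s t with rfl | hst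
  · simp
  · have h := abs_pos.2 (sub_ne_zero.2 hst)
    have : Real.log ((s + t) / |s - t|) ≤ Real.log ((s + t + 3) / |s - t|) :=
      Real.log_le_log (div_pos (by linarith) h) (div_le_div_of_nonneg_right (by linarith) h.le)
    linarith

theorem logMajorant_nonneg {s t : ℝ} (hs : 0 < s) (ht : 0 < t) : 0 ≤ logMajorant (s, t) :=
  (log_add_div_abs_sub_nonneg hs ht).trans (log_add_div_abs_sub_le hs ht)

/-- Separates the two sources of growth: `s + t + 3 ≤ (2+s)(2+t)` splits the behaviour at infinity
into functions of one variable, and `-log|s-t|` is positive only when `|s-t| < 1`. On the diagonal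
the convention `log 0 = 0` makes the bound trivial. -/
theorem logMajorant_le {s t : ℝ} (hs : 0 < s) (ht : 0 < t) :
    logMajorant (s, t) ≤ 2 + Real.log (2 + s) + Real.log (2 + t) +
      (Set.Ioc (-1 : ℝ) 1).indicator (fun u => |Real.log u|) (s - t) := by
  simp only [logMajorant]
  have h1 : 0 ≤ Real.log (2 + s) := Real.log_nonneg (by linarith)
  have h2 : 0 ≤ Real.log (2 + t) := Real.log_nonneg (by linarith)
  have h3 : 0 ≤ (Set.Ioc (-1 : ℝ) 1).indicator (fun u => |Real.log u|) (s - t) :=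
    Set.indicator_nonneg (fun _ _ => abs_nonneg _) _
  rcases eq_or_ne s t with rfl | hst
  · simp only [sub_self, abs_zero, div_zero, Real.log_zero] at *
    linarith
  · have h := abs_pos.2 (sub_ne_zero.2 hst)
    rw [Real.log_div (by linarith) h.ne', Real.log_abs]
    have h4 : Real.log (s + t + 3) ≤ Real.log (2 + s) + Real.log (2 + t) := by
      rw [← Real.log_mul (by linarith) (by linarith)]
      apply Real.log_le_log (by linarith)
      nlinarith
    have h5 : -Real.log (s - t) ≤
        (Set.Ioc (-1 : ℝ) 1).indicator (fun u => |Real.log u|) (s - t) := by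
      by_cases hm : s - t ∈ Set.Ioc (-1 : ℝ) 1
      · rw [Set.indicator_of_mem hm]
        exact neg_le_abs _
      · rw [Set.indicator_of_notMem hm]
        have : 1 ≤ |s - t| := by
          by_contra! hlt
          exact hm ⟨(abs_lt.1 hlt).1, (abs_lt.1 hlt).2.le⟩
        have := Real.log_nonneg this
        rw [Real.log_abs] at this
        linarith
    linarith

/-- The terms of `logMajorant_le` depending on one variable give products of integrable functions.
The singular term is a convolution integrand of `|g|` with an integrable function of `s - t`, once
the bounded factor `|f|` is replaced by its supremum. -/
theorem integrable_mul_logMajorant {δ : ℝ} {f g : ℝ → ℝ} (hδ : 0 < δ) (hf : f ∈ TestClass δ)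
    (hg : g ∈ TestClass δ) :
    Integrable (fun z : ℝ × ℝ => |f z.1| * |g z.2| * logMajorant z) quadrantMeasure := by
  obtain ⟨C, hC, hb⟩ := TestClass.exists_bound hf
  have hfi := (TestClass.integrable hδ.le hf).norm
  have hgi := (TestClass.integrable hδ.le hg).norm
  have hfl := TestClass.integrable_log hδ hf
  have hgl := TestClass.integrable_log hδ hg
  set k : ℝ → ℝ := (Set.Ioc (-1 : ℝ) 1).indicator (fun u => |Real.log u|) with hk
  have hki : Integrable k volume := by
    rw [hk, integrable_indicator_iff measurableSet_Ioc]
    exact ((intervalIntegrable_iff_integrableOn_Ioc_of_le (by norm_num)).1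
      (intervalIntegral.intervalIntegrable_log' (a := -1) (b := 1))).norm
  have hconv : Integrable (fun z : ℝ × ℝ => |g z.2| * k (z.1 - z.2)) quadrantMeasure := by
    have hgi' : Integrable ((Set.Ioi (0 : ℝ)).indicator fun t => |g t|) volume := by
      rw [integrable_indicator_iff measurableSet_Ioi]; exact hgi
    have h := hgi'.convolution_integrand (ContinuousLinearMap.mul ℝ ℝ) hki
    rw [quadrantMeasure, Measure.prod_restrict]
    refine (h.mono_measure Measure.restrict_le_self).congr ?_
    filter_upwards [ae_restrict_mem (measurableSet_Ioi.prod measurableSet_Ioi)] with z hz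
    simp only [ContinuousLinearMap.mul_apply']
    rw [Set.indicator_of_mem hz.2]
  have i1 : Integrable (fun z : ℝ × ℝ => |f z.1| * |g z.2|) quadrantMeasure := hfi.mul_prod hgi
  have i2 : Integrable (fun z : ℝ × ℝ => (Real.log (2 + z.1) * |f z.1|) * |g z.2|)
    quadrantMeasure := hfl.mul_prod hgi
  have i3 : Integrable (fun z : ℝ × ℝ => |f z.1| * (Real.log (2 + z.2) * |g z.2|))
    quadrantMeasure := hfi.mul_prod hgl
  refine Integrable.mono' ((((i1.const_mul 2).add i2).add i3).add (hconv.const_mul C)) ?_ ?_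
  · exact i1.aestronglyMeasurable.mul measurable_logMajorant.aestronglyMeasurable
  · have hb2 : ∀ᵐ z ∂quadrantMeasure, |f z.1| ≤ C :=
      Measure.quasiMeasurePreserving_fst.ae hb
    filter_upwards [ae_quadrant (p := fun z => 0 < z.1 ∧ 0 < z.2) (fun s t hs ht => ⟨hs, ht⟩), hb2]
      with z hz hfz
    have h1 := logMajorant_nonneg hz.1 hz.2
    have h2 := logMajorant_le hz.1 hz.2
    have h3 : 0 ≤ k (z.1 - z.2) := Set.indicator_nonneg (fun _ _ => abs_nonneg _) _
    rw [Real.norm_eq_abs, abs_of_nonneg (by positivity)]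
    simp only [Pi.add_apply]
    calc |f z.1| * |g z.2| * logMajorant z
        ≤ |f z.1| * |g z.2| * (2 + Real.log (2 + z.1) + Real.log (2 + z.2) + k (z.1 - z.2)) := by
          gcongr
      _ = 2 * (|f z.1| * |g z.2|) + Real.log (2 + z.1) * |f z.1| * |g z.2|
          + |f z.1| * (Real.log (2 + z.2) * |g z.2|) + |f z.1| * (|g z.2| * k (z.1 - z.2)) := by
          ring
      _ ≤ _ := by gcongr

theorem integrable_logIntegrand {δ : ℝ} {f g : ℝ → ℝ} (hδ : 0 < δ) (hf : f ∈ TestClass δ)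
    (hg : g ∈ TestClass δ) : Integrable (logIntegrand f g) quadrantMeasure := by
  refine Integrable.mono' (integrable_mul_logMajorant hδ hf hg) ?_ ?_
  · unfold logIntegrand
    exact ((TestClass.integrable hδ.le hf).mul_prod
      (TestClass.integrable hδ.le hg)).aestronglyMeasurable.mul
      (Measurable.aestronglyMeasurable (by fun_prop))
  · refine ae_quadrant fun s t hs ht => ?_
    have h1 := log_add_div_abs_sub_nonneg hs ht
    have h2 := log_add_div_abs_sub_le hs ht
    rw [logIntegrand, Real.norm_eq_abs, abs_mul, abs_mul, abs_of_nonneg h1]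
    gcongr

instance : SFinite quadrantMeasure := by
  unfold quadrantMeasure
  infer_instance

/-! ### Integrals of bounded kernels against test functions -/

section BoundedKernel

variable {Ω : Type*} [MeasurableSpace Ω]

/-- Measurability holds everywhere, not just up to null sets: the exceptional set on which `f`
differs from its measurable version is a set of `t`, the same for every `ω`. -/
theorem measurable_integral_kernel {V : ℝ → Ω → ℝ} (hV : Measurable (Function.uncurry V))
    {f : ℝ → ℝ} (hf : AEStronglyMeasurable f halfLine) :
    Measurable fun ω => ∫ t, V t ω * f t ∂halfLine := by
  have h : (fun ω => ∫ t, V t ω * f t ∂halfLine)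
      = fun ω => ∫ t, V t ω * hf.mk f t ∂halfLine := by
    funext ω
    refine integral_congr_ae ?_
    filter_upwards [hf.ae_eq_mk] with t ht
    rw [ht]
  rw [h]
  have h2 : StronglyMeasurable (fun p : Ω × ℝ => V p.2 p.1 * hf.mk f p.2) :=
    ((hV.comp measurable_swap).mul
      (hf.stronglyMeasurable_mk.measurable.comp measurable_snd)).stronglyMeasurable
  exact h2.integral_prod_right.measurable

theorem integrable_kernel_section {V : ℝ → ℝ} (hV : Measurable V) {C : ℝ}
    (hC : ∀ t, |V t| ≤ C) {f : ℝ → ℝ} (hf : Integrable f halfLine) :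
    Integrable (fun t => V t * f t) halfLine :=
  hf.bdd_mul hV.aestronglyMeasurable (ae_of_all _ hC)

theorem abs_integral_kernel_le {V : ℝ → ℝ} {C : ℝ}
    (hC : ∀ t, |V t| ≤ C) {f : ℝ → ℝ} (hf : Integrable f halfLine) :
    |∫ t, V t * f t ∂halfLine| ≤ C * ∫ t, |f t| ∂halfLine := by
  have h := integral_const_mul (μ := halfLine) C fun t => |f t|
  rw [← h, ← Real.norm_eq_abs]
  refine norm_integral_le_of_norm_le (hf.norm.const_mul C) (ae_of_all _ fun t => ?_)
  rw [Real.norm_eq_abs, abs_mul]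
  exact mul_le_mul_of_nonneg_right (hC t) (abs_nonneg _)

/-- Fubini's theorem for products of two integrals of a bounded kernel. -/
theorem integral_mul_integral_kernel (ρ : Measure Ω) [IsFiniteMeasure ρ] {V : ℝ → Ω → ℝ}
    (hV : Measurable (Function.uncurry V)) {C : ℝ} (hC : ∀ᵐ ω ∂ρ, ∀ t, |V t ω| ≤ C)
    {f g : ℝ → ℝ} (hf : Integrable f halfLine) (hg : Integrable g halfLine) :
    ∫ ω, (∫ t, V t ω * f t ∂halfLine) * (∫ t, V t ω * g t ∂halfLine) ∂ρ
      = ∫ z, f z.1 * g z.2 * (∫ ω, V z.1 ω * V z.2 ω ∂ρ) ∂quadrantMeasure := by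
  have h1 : ∀ ω, (∫ t, V t ω * f t ∂halfLine) * (∫ t, V t ω * g t ∂halfLine)
      = ∫ z, f z.1 * g z.2 * (V z.1 ω * V z.2 ω) ∂quadrantMeasure := by
    intro ω
    rw [quadrantMeasure, ← integral_prod_mul]
    exact integral_congr_ae (ae_of_all _ fun z => by ring)
  simp_rw [h1]
  rw [integral_integral_swap]
  · simp_rw [integral_const_mul]
  · have hfg : Integrable (fun z : ℝ × ℝ => f z.1 * g z.2) quadrantMeasure := hf.mul_prod hg
    have hint : Integrable (fun p : Ω × (ℝ × ℝ) => (C * C) * |f p.2.1 * g p.2.2|)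
        (ρ.prod quadrantMeasure) := (integrable_const (C * C)).mul_prod hfg.norm
    refine Integrable.mono' hint ?_ ?_
    · refine AEStronglyMeasurable.mul ?_ ?_
      · exact hfg.aestronglyMeasurable.comp_snd
      · refine Measurable.aestronglyMeasurable ?_
        exact (hV.comp ((measurable_fst.comp measurable_snd).prodMk measurable_fst)).mul
          (hV.comp ((measurable_snd.comp measurable_snd).prodMk measurable_fst))
    · filter_upwards [Measure.quasiMeasurePreserving_fst.ae hC] with p hp
      simp only [Function.uncurry, Real.norm_eq_abs]
      rw [abs_mul, abs_mul (V _ _), mul_comm]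
      have := (abs_nonneg _).trans (hp 0)
      gcongr
      · exact hp _
      · exact hp _

end BoundedKernel

/-! ### Parity of the Poisson process -/

section Poisson

variable {Ω' : Type*} {N : ℝ≥0 → Ω' → ℕ}

theorem integral_neg_one_pow_poissonMeasure (r : ℝ≥0) :
    ∫ n, (-1 : ℝ) ^ n ∂(poissonMeasure r) = Real.exp (-(2 * r)) := by
  rw [integral_poissonMeasure]
  have h := (NormedSpace.expSeries_div_hasSum_exp (-(r : ℝ))).mul_left (Real.exp (-r))
  rw [← Real.exp_eq_exp_ℝ, ← Real.exp_add] at h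
  rw [show -(2 * (r : ℝ)) = -r + -r by ring, ← h.tsum_eq]
  congr 1
  funext n
  rw [neg_pow (r : ℝ) n, smul_eq_mul]
  ring

/-- The sign `(-1)^{N(x)}`. -/
def paritySign (N : ℝ≥0 → Ω' → ℕ) (x : ℝ) (ω : Ω') : ℝ := (-1) ^ N x.toNNReal ω

theorem abs_paritySign (x : ℝ) (ω : Ω') : |paritySign N x ω| = 1 := by
  simp [paritySign, abs_pow]

theorem indicator_oddEvent (x : ℝ) (ω : Ω') :
    (oddEvent N x).indicator (fun _ => (1 : ℝ)) ω = (1 - paritySign N x ω) / 2 := by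
  by_cases h : Odd (N x.toNNReal ω)
  · rw [Set.indicator_of_mem (show ω ∈ oddEvent N x from h), paritySign, h.neg_one_pow]
    norm_num
  · rw [Set.indicator_of_notMem (show ω ∉ oddEvent N x from h), paritySign,
      (Nat.not_odd_iff_even.1 h).neg_one_pow]
    norm_num

/-- The centered indicator of the event that `N(x)` is odd. -/
def centeredOdd (N : ℝ≥0 → Ω' → ℕ) (x : ℝ) (ω : Ω') : ℝ :=
  -- The truncation `max x 0` matches `toNNReal` in the sign and keeps the uniform bound valid for
  -- negative `x`.
  (Real.exp (-(2 * max x 0)) - paritySign N x ω) / 2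

theorem abs_centeredOdd_le (x : ℝ) (ω : Ω') : |centeredOdd N x ω| ≤ 1 := by
  have h1 : Real.exp (-(2 * max x 0)) ≤ 1 := Real.exp_le_one_iff.2 (by simp)
  have h2 := (abs_le.1 (abs_paritySign (N := N) x ω).le)
  have h3 := Real.exp_pos (-(2 * max x 0))
  rw [centeredOdd, abs_le]
  constructor <;> linarith

variable [MeasurableSpace Ω'] {P' : Measure Ω'}

/-- Joint measurability comes from right-continuity: time is approximated from the right by points
of the grid of mesh `1/(k+1)`, and each approximation uses only countably many times. -/
theorem IsStandardPoisson.measurable_uncurry (hN : IsStandardPoisson N P') :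
    Measurable fun z : ℝ × Ω' => N z.1.toNNReal z.2 := by
  have h1 : ∀ k : ℕ, Measurable fun z : ℝ × Ω' =>
      N (((⌊z.1.toNNReal * (k + 1)⌋₊ : ℝ≥0) + 1) / (k + 1)) z.2 := by
    intro k
    let F : ℕ × Ω' → ℕ := fun p => N (((p.1 : ℝ≥0) + 1) / (k + 1)) p.2
    have h2 : Measurable F := measurable_from_prod_countable_right fun j => by
      change Measurable (N (((j : ℝ≥0) + 1) / (k + 1)))
      exact hN.measurable _
    have h3 : Measurable fun z : ℝ × Ω' => (⌊z.1.toNNReal * (k + 1)⌋₊, z.2) := by fun_prop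
    have h4 : (fun z : ℝ × Ω' => N (((⌊z.1.toNNReal * (k + 1)⌋₊ : ℝ≥0) + 1) / (k + 1)) z.2)
        = F ∘ fun z : ℝ × Ω' => (⌊z.1.toNNReal * (k + 1)⌋₊, z.2) := by
      funext z
      simp only [F, Function.comp_apply]
    rw [h4]
    exact h2.comp h3
  refine measurable_of_tendsto_metrizable h1 ?_
  rw [tendsto_pi_nhds]
  rintro ⟨x, ω⟩
  set y := x.toNNReal with hy
  have hy1 : ∀ k : ℕ, y ≤ ((⌊y * (k + 1)⌋₊ : ℝ≥0) + 1) / (k + 1) := by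
    intro k
    rw [le_div_iff₀ (by positivity)]
    exact (Nat.lt_floor_add_one _).le
  have hy2 : ∀ k : ℕ, ((⌊y * (k + 1)⌋₊ : ℝ≥0) + 1) / (k + 1) ≤ y + 1 / (k + 1) := by
    intro k
    rw [add_div]
    gcongr
    rw [div_le_iff₀ (by positivity)]
    exact Nat.floor_le (by positivity)
  have ht : Tendsto (fun k : ℕ => ((⌊y * (k + 1)⌋₊ : ℝ≥0) + 1) / (k + 1)) atTop (𝓝[Set.Ici y] y) := by
    refine tendsto_nhdsWithin_iff.2 ⟨?_, Eventually.of_forall hy1⟩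
    refine tendsto_of_tendsto_of_tendsto_of_le_of_le tendsto_const_nhds ?_ hy1 hy2
    have : Tendsto (fun k : ℕ => y + 1 / ((k : ℝ≥0) + 1)) atTop (𝓝 (y + 0)) :=
      tendsto_const_nhds.add tendsto_one_div_add_atTop_nhds_zero_nat
    simpa using this
  exact (hN.right_cont ω y).tendsto.comp ht

theorem IsStandardPoisson.measurable_paritySign (hN : IsStandardPoisson N P') :
    Measurable (Function.uncurry (paritySign N)) :=
  (measurable_of_countable fun n : ℕ => (-1 : ℝ) ^ n).comp hN.measurable_uncurry

/-- The product of the two signs is `(-1)` to the power of the increment, a Poisson variable of mean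
`|x-y|`; the jumps before the earlier time are counted twice and cancel. -/
theorem IsStandardPoisson.integral_paritySign_mul (hN : IsStandardPoisson N P') {x y : ℝ}
    (hx : 0 ≤ x) (hy : 0 ≤ y) :
    ∫ ω, paritySign N x ω * paritySign N y ω ∂P' = Real.exp (-(2 * |x - y|)) := by
  wlog hxy : x ≤ y generalizing x y
  · rw [abs_sub_comm, ← this hy hx (le_of_not_ge hxy)]
    simp_rw [mul_comm]
  have hle : x.toNNReal ≤ y.toNNReal := Real.toNNReal_mono hxy
  have h1 := (hN.law _ _ hle).integral_comp (f := fun n : ℕ => (-1 : ℝ) ^ n)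
    (measurable_of_countable _).aestronglyMeasurable
  rw [integral_neg_one_pow_poissonMeasure] at h1
  have h2 : ((y.toNNReal - x.toNNReal : ℝ≥0) : ℝ) = |x - y| := by
    rw [NNReal.coe_sub hle, Real.coe_toNNReal _ hx, Real.coe_toNNReal _ hy, abs_sub_comm,
      abs_of_nonneg (by linarith)]
  rw [← h2, ← h1]
  refine integral_congr_ae (ae_of_all _ fun ω => ?_)
  have h3 := hN.mono ω hle
  simp only [paritySign, Function.comp_apply, ← pow_add]
  obtain ⟨d, hd⟩ := Nat.exists_eq_add_of_le h3
  simp only at hd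
  rw [hd, Nat.add_sub_cancel_left, ← add_assoc, pow_add, ← two_mul, pow_mul]
  simp

theorem IsStandardPoisson.integral_paritySign (hN : IsStandardPoisson N P') {x : ℝ}
    (hx : 0 ≤ x) : ∫ ω, paritySign N x ω ∂P' = Real.exp (-(2 * x)) := by
  have := hN.integral_paritySign_mul hx le_rfl
  rw [sub_zero, abs_of_nonneg hx] at this
  rw [← this]
  refine integral_congr_ae (ae_of_all _ fun ω => ?_)
  simp [paritySign, hN.zero]

theorem IsStandardPoisson.measurable_centeredOdd (hN : IsStandardPoisson N P') :
    Measurable (Function.uncurry (centeredOdd N)) := by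
  have := hN.measurable_paritySign
  have h2 : Measurable fun z : ℝ × Ω' => Real.exp (-(2 * max z.1 0)) := by fun_prop
  exact (h2.sub this).div_const 2

variable [IsProbabilityMeasure P']

theorem IsStandardPoisson.integrable_paritySign (hN : IsStandardPoisson N P') (x : ℝ) :
    Integrable (paritySign N x) P' :=
  Integrable.of_bound (hN.measurable_paritySign.comp (measurable_const.prodMk
    measurable_id)).aestronglyMeasurable 1 (ae_of_all _ fun ω => (abs_paritySign x ω).le)

theorem IsStandardPoisson.integrable_paritySign_mul (hN : IsStandardPoisson N P') (x y : ℝ) :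
    Integrable (fun ω => paritySign N x ω * paritySign N y ω) P' :=
  (hN.integrable_paritySign y).bdd_mul (hN.integrable_paritySign x).aestronglyMeasurable
    (ae_of_all _ fun ω => (abs_paritySign x ω).le)

theorem IsStandardPoisson.measureReal_oddEvent (hN : IsStandardPoisson N P') {x : ℝ}
    (hx : 0 ≤ x) : P'.real (oddEvent N x) = (1 - Real.exp (-(2 * x))) / 2 := by
  have hm : MeasurableSet (oddEvent N x) :=
    (hN.measurable x.toNNReal) (MeasurableSet.of_discrete (s := {n : ℕ | Odd n}))
  rw [← hN.integral_paritySign hx, ← integral_indicator_one hm]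
  have : (oddEvent N x).indicator (1 : Ω' → ℝ) = fun ω => (1 - paritySign N x ω) / 2 := by
    funext ω
    exact indicator_oddEvent x ω
  rw [this, integral_div, integral_sub (integrable_const _) (hN.integrable_paritySign x)]
  simp

theorem IsStandardPoisson.indicator_sub (hN : IsStandardPoisson N P') {x : ℝ} (hx : 0 ≤ x)
    (ω : Ω') : (oddEvent N x).indicator (fun _ => (1 : ℝ)) ω - P'.real (oddEvent N x)
      = centeredOdd N x ω := by
  rw [indicator_oddEvent, hN.measureReal_oddEvent hx, centeredOdd, max_eq_left hx]
  ring

theorem IsStandardPoisson.integral_centeredOdd_mul (hN : IsStandardPoisson N P') {x y : ℝ}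
    (hx : 0 ≤ x) (hy : 0 ≤ y) :
    ∫ ω, centeredOdd N x ω * centeredOdd N y ω ∂P'
      = (Real.exp (-(2 * |x - y|)) - Real.exp (-(2 * (x + y)))) / 4 := by
  simp only [centeredOdd, max_eq_left hx, max_eq_left hy]
  set a := Real.exp (-(2 * x)) with ha
  set b := Real.exp (-(2 * y)) with hb
  have hab : Real.exp (-(2 * (x + y))) = a * b := by
    rw [ha, hb, ← Real.exp_add]; congr 1; ring
  have h : ∀ ω, (a - paritySign N x ω) / 2 * ((b - paritySign N y ω) / 2)
      = (a * b - a * paritySign N y ω - b * paritySign N x ω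
        + paritySign N x ω * paritySign N y ω) / 4 := fun ω => by ring
  simp_rw [h]
  have i1 := (hN.integrable_paritySign y).const_mul a
  have i2 := (hN.integrable_paritySign x).const_mul b
  have i0 := integrable_const (μ := P') (a * b)
  have i3 : Integrable (fun ω => a * b - a * paritySign N y ω) P' := i0.sub i1
  have i4 : Integrable (fun ω => a * b - a * paritySign N y ω - b * paritySign N x ω) P' :=
    i3.sub i2
  rw [integral_div, integral_add i4 (hN.integrable_paritySign_mul x y),
    integral_sub i3 i2, integral_sub i0 i1, integral_const_mul a (paritySign N y),
    integral_const_mul b (paritySign N x),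
    hN.integral_paritySign_mul hx hy, hN.integral_paritySign hx, hN.integral_paritySign hy, hab]
  simp only [integral_const, probReal_univ, smul_eq_mul, one_mul]
  ring

end Poisson

/-! ### Frullani's integral for the exponential -/

/-- Near zero the singularity `r⁻¹` is cancelled by `1 - e^{-(β-α)r} ≤ (β-α) r`; the remaining
factor `e^{-αr}` is integrable. -/
theorem integrableOn_frullani_exp {α β : ℝ} (hα : 0 < α) (hαβ : α ≤ β) :
    Integrable (fun r : ℝ => r⁻¹ * (Real.exp (-(α * r)) - Real.exp (-(β * r)))) halfLine := by
  have h1 : Integrable (fun r : ℝ => (β - α) * Real.exp (-α * r)) halfLine :=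
    (exp_neg_integrableOn_Ioi 0 hα).const_mul _
  refine Integrable.mono' h1 (Measurable.aestronglyMeasurable (by fun_prop)) ?_
  filter_upwards [ae_restrict_mem measurableSet_Ioi] with r (hr : (0 : ℝ) < r)
  have h2 : Real.exp (-(β * r)) ≤ Real.exp (-(α * r)) := by
    gcongr
  have h3 : Real.exp (-(β * r)) = Real.exp (-(α * r)) * Real.exp (-((β - α) * r)) := by
    rw [← Real.exp_add]; congr 1; ring
  have h4 := Real.add_one_le_exp (-((β - α) * r))
  rw [Real.norm_eq_abs, abs_of_nonneg (mul_nonneg (by positivity) (by linarith)), h3,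
    inv_mul_le_iff₀ hr, neg_mul]
  nlinarith [Real.exp_pos (-(α * r))]

theorem integral_frullani_exp {α β : ℝ} (hα : 0 < α) (hαβ : α ≤ β) :
    ∫ r, r⁻¹ * (Real.exp (-(α * r)) - Real.exp (-(β * r))) ∂halfLine = Real.log (β / α) := by
  have hβ := hα.trans_le hαβ
  have hL : Tendsto (fun x : ℝ => Real.exp (-x)) (𝓝[>] 0) (𝓝 1) := by
    have : Continuous fun x : ℝ => Real.exp (-x) := by fun_prop
    have h := (this.tendsto 0).mono_left (nhdsWithin_le_nhds (s := Set.Ioi 0))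
    simpa using h
  have h := Frullani.integral_Ioi_eq (f := fun x : ℝ => Real.exp (-x)) (a := α) (b := β)
    (((by fun_prop : Continuous fun x : ℝ => Real.exp (-x)).locallyIntegrable).locallyIntegrableOn
      _) hα hβ hL
    (Real.tendsto_exp_neg_atTop_nhds_zero) (integrableOn_frullani_exp hα hαβ)
  simpa using h

/-- The covariance kernel of the centered parity process. -/
def expKernel (r : ℝ) (z : ℝ × ℝ) : ℝ :=
  Real.exp (-(2 * |z.1 - z.2| * r)) - Real.exp (-(2 * (z.1 + z.2) * r))

theorem measurable_expKernel : Measurable fun p : ℝ × (ℝ × ℝ) => expKernel p.1 p.2 := by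
  unfold expKernel
  fun_prop

theorem expKernel_nonneg {r s t : ℝ} (hr : 0 < r) (hs : 0 < s) (ht : 0 < t) :
    0 ≤ expKernel r (s, t) := by
  have : |s - t| ≤ s + t := by rw [abs_le]; constructor <;> linarith
  simp only [expKernel, sub_nonneg]
  gcongr

section FrullaniFubini

variable {δ : ℝ} {f g : ℝ → ℝ}

/-- Frullani's formula off the diagonal, with rates `2|s-t|` and `2(s+t)`. Because `expKernel` is
nonnegative, the integral of the absolute value is again the logarithm, so Fubini's theorem reduces
to integrability of `logIntegrand`. -/
theorem ae_expKernel (f g : ℝ → ℝ) : ∀ᵐ z ∂quadrantMeasure,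
    Integrable (fun r : ℝ => r⁻¹ * (f z.1 * g z.2 * expKernel r z)) halfLine ∧
    ∫ r, r⁻¹ * (f z.1 * g z.2 * expKernel r z) ∂halfLine = logIntegrand f g z ∧
    ∫ r, ‖r⁻¹ * (f z.1 * g z.2 * expKernel r z)‖ ∂halfLine = ‖logIntegrand f g z‖ := by
  filter_upwards [ae_quadrant_ne, ae_quadrant (p := fun z => 0 < z.1 ∧ 0 < z.2)
    fun s t hs ht => ⟨hs, ht⟩] with z hz hpos
  have h1 : 0 < 2 * |z.1 - z.2| := mul_pos two_pos (abs_pos.2 (sub_ne_zero.2 hz))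
  have h2 : 2 * |z.1 - z.2| ≤ 2 * (z.1 + z.2) := by
    gcongr
    rw [abs_le]; constructor <;> linarith [hpos.1, hpos.2]
  have h3 : ∀ r : ℝ, r⁻¹ * (f z.1 * g z.2 * expKernel r z)
      = f z.1 * g z.2 * (r⁻¹ * expKernel r z) := fun r => by ring
  have hi := integrableOn_frullani_exp h1 h2
  have hv := integral_frullani_exp h1 h2
  rw [mul_div_mul_left _ _ two_ne_zero] at hv
  refine ⟨?_, ?_, ?_⟩
  · simp_rw [h3]
    exact hi.const_mul _
  · simp_rw [h3]
    rw [integral_const_mul, logIntegrand, ← hv]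
    rfl
  · simp_rw [h3, norm_mul (f z.1 * g z.2)]
    rw [integral_const_mul, logIntegrand, norm_mul (f z.1 * g z.2),
      Real.norm_of_nonneg (log_add_div_abs_sub_nonneg hpos.1 hpos.2), ← hv]
    congr 1
    refine integral_congr_ae ?_
    filter_upwards [ae_restrict_mem measurableSet_Ioi] with r (hr : (0 : ℝ) < r)
    exact Real.norm_of_nonneg (mul_nonneg (by positivity) (expKernel_nonneg hr hpos.1 hpos.2))

theorem integrable_frullani_kernel (hδ : 0 < δ) (hf : f ∈ TestClass δ) (hg : g ∈ TestClass δ) :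
    Integrable (fun p : ℝ × (ℝ × ℝ) => p.1⁻¹ * (f p.2.1 * g p.2.2 * expKernel p.1 p.2))
      (halfLine.prod quadrantMeasure) := by
  have hfg : AEStronglyMeasurable (fun z : ℝ × ℝ => f z.1 * g z.2) quadrantMeasure :=
    ((TestClass.integrable hδ.le hf).mul_prod
      (TestClass.integrable hδ.le hg)).aestronglyMeasurable
  have hm : AEStronglyMeasurable
      (fun p : ℝ × (ℝ × ℝ) => p.1⁻¹ * (f p.2.1 * g p.2.2 * expKernel p.1 p.2))
      (halfLine.prod quadrantMeasure) :=
    (Measurable.aestronglyMeasurable (by fun_prop)).mul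
      ((hfg.comp_snd).mul measurable_expKernel.aestronglyMeasurable)
  have h := ae_expKernel f g
  refine (integrable_prod_iff' hm).2 ⟨h.mono fun z hz => hz.1, ?_⟩
  exact (integrable_logIntegrand hδ hf hg).norm.congr (h.mono fun z hz => hz.2.2.symm)

theorem integral_frullani_kernel (hδ : 0 < δ) (hf : f ∈ TestClass δ) (hg : g ∈ TestClass δ) :
    ∫ r, r⁻¹ * (∫ z, f z.1 * g z.2 * expKernel r z ∂quadrantMeasure) ∂halfLine
      = ∫ z, logIntegrand f g z ∂quadrantMeasure := by
  simp_rw [← integral_const_mul]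
  rw [integral_integral_swap (integrable_frullani_kernel hδ hf hg)]
  exact integral_congr_ae ((ae_expKernel f g).mono fun z hz => hz.2.1)

end FrullaniFubini

/-! ### The integrand of the limit process -/

section LimitProcess

variable {Ω' : Type*} [MeasurableSpace Ω'] {P' : Measure Ω'} [IsProbabilityMeasure P']
  {N : ℝ≥0 → Ω' → ℕ} {δ : ℝ} {f g : ℝ → ℝ}

theorem IsStandardPoisson.oddKernel_eq (hN : IsStandardPoisson N P') (f : ℝ → ℝ) {r : ℝ}
    (hr : 0 < r) (ω : Ω') :
    oddKernel N P' f (r, ω) = ∫ t, centeredOdd N (r * t) ω * f t ∂halfLine := by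
  refine integral_congr_ae ?_
  filter_upwards [ae_restrict_mem measurableSet_Ioi] with t (ht : (0 : ℝ) < t)
  rw [hN.indicator_sub (by positivity)]

/-- The radial part `2 r⁻¹ dr` of the control measure. -/
def radialMeasure : Measure ℝ := halfLine.withDensity fun r => ENNReal.ofReal (2 / r)

theorem measurable_radialDensity : Measurable fun r : ℝ => ENNReal.ofReal (2 / r) := by fun_prop

instance : SFinite radialMeasure := by
  unfold radialMeasure
  infer_instance

theorem controlMeasure_eq (P' : Measure Ω') : controlMeasure P' = radialMeasure.prod P' := rfl

theorem ae_radialMeasure_pos : ∀ᵐ r ∂radialMeasure, 0 < r := by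
  refine (withDensity_absolutelyContinuous _ _).ae_le ?_
  exact ae_restrict_mem measurableSet_Ioi

theorem IsStandardPoisson.aestronglyMeasurable_oddKernel (hN : IsStandardPoisson N P')
    (hf : AEStronglyMeasurable f halfLine) :
    AEStronglyMeasurable (oddKernel N P' f) (controlMeasure P') := by
  have hV : Measurable (Function.uncurry fun (t : ℝ) (z : ℝ × Ω') =>
      centeredOdd N (z.1 * t) z.2) := by
    have h : Measurable fun p : ℝ × (ℝ × Ω') => (p.2.1 * p.1, p.2.2) := by fun_prop
    exact hN.measurable_centeredOdd.comp h
  refine (measurable_integral_kernel hV hf).aestronglyMeasurable.congr ?_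
  rw [controlMeasure_eq]
  filter_upwards [Measure.quasiMeasurePreserving_fst.ae ae_radialMeasure_pos] with z hz
  exact (hN.oddKernel_eq f hz z.2).symm

theorem IsStandardPoisson.integral_oddKernel_mul (hN : IsStandardPoisson N P')
    (hf : Integrable f halfLine) (hg : Integrable g halfLine) {r : ℝ} (hr : 0 < r) :
    ∫ ω, oddKernel N P' f (r, ω) * oddKernel N P' g (r, ω) ∂P'
      = (∫ z, f z.1 * g z.2 * expKernel r z ∂quadrantMeasure) / 4 := by
  have hV : Measurable (Function.uncurry fun (t : ℝ) (ω : Ω') => centeredOdd N (r * t) ω) := by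
    have h : Measurable fun p : ℝ × Ω' => (r * p.1, p.2) := by fun_prop
    exact hN.measurable_centeredOdd.comp h
  simp_rw [hN.oddKernel_eq _ hr]
  rw [integral_mul_integral_kernel P' hV (C := 1)
    (ae_of_all _ fun ω t => abs_centeredOdd_le _ _) hf hg, ← integral_div]
  refine integral_congr_ae (ae_quadrant fun s t hs ht => ?_)
  simp only
  rw [hN.integral_centeredOdd_mul (by positivity) (by positivity), expKernel]
  simp only
  rw [show |r * s - r * t| = |s - t| * r by rw [← mul_sub, abs_mul, abs_of_pos hr, mul_comm],
    show 2 * (|s - t| * r) = 2 * |s - t| * r by ring,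
    show 2 * (r * s + r * t) = 2 * (s + t) * r by ring]
  ring

/-- For fixed `r` the second moment is the quadratic form of `expKernel r`, divided by `4`; its
integrability against the radial measure is a marginal of `integrable_frullani_kernel`. -/
theorem IsStandardPoisson.memLp_oddKernel (hN : IsStandardPoisson N P') (hδ : 0 < δ)
    (hf : f ∈ TestClass δ) : MemLp (oddKernel N P' f) 2 (controlMeasure P') := by
  have hfi := TestClass.integrable hδ.le hf
  have hm := hN.aestronglyMeasurable_oddKernel hfi.aestronglyMeasurable
  rw [memLp_two_iff_integrable_sq hm]
  rw [controlMeasure_eq] at hm ⊢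
  have hrad : Integrable (fun r => (∫ z, f z.1 * f z.2 * expKernel r z ∂quadrantMeasure) / 4)
      radialMeasure := by
    rw [radialMeasure, integrable_withDensity_iff_integrable_smul' measurable_radialDensity
      (ae_of_all _ fun r => ENNReal.ofReal_lt_top)]
    -- The density `2/r` times the factor `1/4` leaves `r⁻¹/2`.
    refine (((integrable_frullani_kernel hδ hf hf).integral_prod_left).div_const 2).congr ?_
    filter_upwards [ae_restrict_mem measurableSet_Ioi] with r (hr : (0 : ℝ) < r)
    rw [integral_const_mul, ENNReal.toReal_ofReal (by positivity), smul_eq_mul]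
    field_simp
    norm_num
  refine (integrable_prod_iff (hm.pow 2)).2 ⟨?_, ?_⟩
  · have hm2 := hm.prodMk_left
    filter_upwards [hm2, ae_radialMeasure_pos] with r hr hr0
    refine Integrable.of_bound (hr.pow 2) ((∫ t, |f t| ∂halfLine) ^ 2) (ae_of_all _ fun ω => ?_)
    rw [Pi.pow_apply, norm_pow]
    refine pow_le_pow_left₀ (norm_nonneg _) ?_ 2
    rw [Real.norm_eq_abs]
    rw [hN.oddKernel_eq f hr0]
    simpa using abs_integral_kernel_le (V := fun t => centeredOdd N (r * t) ω) (C := 1)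
      (fun t => abs_centeredOdd_le _ _) hfi
  · refine hrad.congr ?_
    filter_upwards [ae_radialMeasure_pos] with r hr
    rw [← hN.integral_oddKernel_mul hfi hfi hr]
    refine integral_congr_ae (ae_of_all _ fun ω => ?_)
    simp [sq]

/-- The constants cancel exactly: `2` from the normalization of `M`, `2/r` from the control measure
and `1/4` from the centered indicators multiply to the Frullani weight `1/r`. -/
theorem IsStandardPoisson.two_mul_integral_oddKernel (hN : IsStandardPoisson N P') (hδ : 0 < δ)
    (hf : f ∈ TestClass δ) (hg : g ∈ TestClass δ) :
    2 * ∫ z, oddKernel N P' f z * oddKernel N P' g z ∂(controlMeasure P')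
      = ∫ z, logIntegrand f g z ∂quadrantMeasure := by
  have hi := (hN.memLp_oddKernel hδ hf).integrable_mul (hN.memLp_oddKernel hδ hg)
  have hi' : Integrable (fun z => oddKernel N P' f z * oddKernel N P' g z)
    (radialMeasure.prod P') := hi
  rw [controlMeasure_eq, integral_prod _ hi', ← integral_frullani_kernel hδ hf hg]
  have h1 : ∫ r, ∫ ω, oddKernel N P' f (r, ω) * oddKernel N P' g (r, ω) ∂P' ∂radialMeasure
      = ∫ r, (∫ z, f z.1 * g z.2 * expKernel r z ∂quadrantMeasure) / 4 ∂radialMeasure := by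
    refine integral_congr_ae ?_
    filter_upwards [ae_radialMeasure_pos] with r hr
    exact hN.integral_oddKernel_mul (TestClass.integrable hδ.le hf)
      (TestClass.integrable hδ.le hg) hr
  rw [h1, radialMeasure, integral_withDensity_eq_integral_toReal_smul measurable_radialDensity
    (ae_of_all _ fun r => ENNReal.ofReal_lt_top), ← integral_const_mul]
  refine integral_congr_ae ?_
  filter_upwards [ae_restrict_mem measurableSet_Ioi] with r (hr : (0 : ℝ) < r)
  rw [ENNReal.toReal_ofReal (by positivity), smul_eq_mul]
  ring

variable {Ω₁ : Type*} [MeasurableSpace Ω₁] {Q : Measure Ω₁} {I : (ℝ × Ω' → ℝ) → Ω₁ → ℝ}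

theorem IsGaussianIntegral.isGaussianProcess_limitProcess
    (hI : IsGaussianIntegral I (controlMeasure P') Q) (hN : IsStandardPoisson N P') (hδ : 0 < δ) :
    IsGaussianProcess (fun f : TestClass δ => limitProcess N P' I f.1) Q :=
  hI.gaussian.comp_right fun f : TestClass δ => ⟨oddKernel N P' f.1, hN.memLp_oddKernel hδ f.2⟩

theorem IsGaussianIntegral.covariance_limitProcess
    (hI : IsGaussianIntegral I (controlMeasure P') Q) (hN : IsStandardPoisson N P') (hδ : 0 < δ)
    (hf : f ∈ TestClass δ) (hg : g ∈ TestClass δ) :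
    cov[limitProcess N P' I f, limitProcess N P' I g; Q]
      = ∫ z, logIntegrand f g z ∂quadrantMeasure := by
  rw [← hN.two_mul_integral_oddKernel hδ hf hg]
  exact hI.cov _ _ (hN.memLp_oddKernel hδ hf) (hN.memLp_oddKernel hδ hg)

end LimitProcess

/-! ### The kernel of the prelimit covariance -/

/-- The unit interval with Lebesgue measure, the law of the Bernoulli parameter. -/
abbrev unitMeasure : Measure ℝ := volume.restrict (Set.Ioo (0 : ℝ) 1)

/-- The conditional covariance of `(-1)^{τ_j}` and `(-1)^{τ_k}` given the parameter `u`. -/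
def signKernel (u : ℝ) (j k : ℕ) : ℝ :=
  (1 - 2 * u) ^ (max j k - min j k) - (1 - 2 * u) ^ (j + k)

theorem measurable_signKernel (j k : ℕ) : Measurable fun u => signKernel u j k := by
  unfold signKernel
  fun_prop

theorem add_eq_sub_add_two_mul (j k : ℕ) : j + k = (max j k - min j k) + 2 * min j k := by omega

/-- After factoring out `(1-2u)^a`, Bernoulli's inequality applies to `(1-2u)^{2d} = (1 -
4u(1-u))^d`. The linear bound compensates the weight `u⁻¹` near zero; the bound `1` serves for
larger `u`. -/
theorem abs_one_sub_two_mul_pow_sub_le {u : ℝ} (hu : u ∈ Set.Ioo (0 : ℝ) 1) (a d : ℕ) :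
    |(1 - 2 * u) ^ a - (1 - 2 * u) ^ (a + 2 * d)| ≤ min 1 (4 * u * d) := by
  have h1 : |1 - 2 * u| ≤ 1 := by rw [abs_le]; constructor <;> linarith [hu.1, hu.2]
  have h2 : (1 - 2 * u) ^ (2 * d) ≤ 1 := by
    rw [pow_mul]
    exact pow_le_one₀ (sq_nonneg _) ((sq_le_one_iff_abs_le_one _).2 h1)
  have h3 : 0 ≤ (1 - 2 * u) ^ (2 * d) := by
    rw [pow_mul]
    exact pow_nonneg (sq_nonneg _) _
  have h4 : 1 - 4 * u * d ≤ (1 - 2 * u) ^ (2 * d) := by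
    have h5 : (1 - 2 * u) ^ 2 = 1 + -(4 * u * (1 - u)) := by ring
    have h6 := one_add_mul_le_pow (a := -(4 * u * (1 - u)))
      (by nlinarith [sq_nonneg (2 * u - 1), hu.1, hu.2]) d
    rw [pow_mul, h5]
    have h7 : 0 ≤ 4 * u * u * d := by have := hu.1; positivity
    nlinarith
  have h8 : |(1 - 2 * u) ^ a| ≤ 1 := by
    rw [abs_pow]
    exact pow_le_one₀ (abs_nonneg _) h1
  rw [show (1 - 2 * u) ^ a - (1 - 2 * u) ^ (a + 2 * d)
    = (1 - 2 * u) ^ a * (1 - (1 - 2 * u) ^ (2 * d)) by rw [pow_add]; ring, abs_mul,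
    abs_of_nonneg (by linarith : 0 ≤ 1 - (1 - 2 * u) ^ (2 * d))]
  have h9 : |(1 - 2 * u) ^ a| * (1 - (1 - 2 * u) ^ (2 * d)) ≤ 1 - (1 - 2 * u) ^ (2 * d) :=
    mul_le_of_le_one_left (by linarith) h8
  exact le_min (by linarith) (by linarith)

theorem abs_signKernel_le {u : ℝ} (hu : u ∈ Set.Ioo (0 : ℝ) 1) (j k : ℕ) :
    |signKernel u j k| ≤ min 1 (4 * u * j) := by
  have h := abs_one_sub_two_mul_pow_sub_le hu (max j k - min j k) (min j k)
  rw [← add_eq_sub_add_two_mul] at h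
  refine h.trans (min_le_min le_rfl ?_)
  have := hu.1
  gcongr
  exact min_le_left _ _

theorem integral_one_sub_two_mul_pow (n : ℕ) :
    ∫ u in (0 : ℝ)..1, (1 - 2 * u) ^ n = (1 - (-1) ^ (n + 1)) / (2 * (n + 1)) := by
  rw [intervalIntegral.integral_comp_sub_mul (fun x : ℝ => x ^ n) two_ne_zero, integral_pow]
  norm_num
  field_simp

/-- The mean of the kernel with weight `u⁻¹`, in terms of `a = |j - k|` and `d = min j k`. -/
def harmonicKernel (a d : ℕ) : ℝ :=
  ∫ u, u⁻¹ * ((1 - 2 * u) ^ a - (1 - 2 * u) ^ (a + 2 * d)) ∂unitMeasure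

theorem integrable_inv_mul_pow_sub_pow (a d : ℕ) :
    Integrable (fun u : ℝ => u⁻¹ * ((1 - 2 * u) ^ a - (1 - 2 * u) ^ (a + 2 * d))) unitMeasure := by
  refine Integrable.mono' (integrable_const (4 * (d : ℝ)))
    (Measurable.aestronglyMeasurable (by fun_prop)) ?_
  filter_upwards [ae_restrict_mem measurableSet_Ioo] with u hu
  have h := (abs_one_sub_two_mul_pow_sub_le hu a d).trans (min_le_right _ _)
  rw [Real.norm_eq_abs, abs_mul, abs_of_pos (inv_pos.2 hu.1), inv_mul_le_iff₀ hu.1]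
  linarith

theorem harmonicKernel_zero (a : ℕ) : harmonicKernel a 0 = 0 := by
  simp [harmonicKernel]

/-- The weight cancels because `(1 - (1-2u)²)/u = 4(1-u) = 2 + 2(1-2u)`. The increment in `d` is
thus an integral of two powers of `1-2u`, which vanishes for odd exponents by symmetry about `u =
1/2`. -/
theorem harmonicKernel_succ (a d : ℕ) : harmonicKernel a (d + 1) = harmonicKernel a d
    + ((1 - (-1) ^ (a + 2 * d + 1)) / ((a + 2 * d : ℝ) + 1)
      + (1 - (-1) ^ (a + 2 * d + 2)) / ((a + 2 * d : ℝ) + 2)) := by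
  have h1 : (1 - (-1 : ℝ) ^ (a + 2 * d + 1)) / ((a + 2 * d : ℝ) + 1)
      + (1 - (-1) ^ (a + 2 * d + 2)) / ((a + 2 * d : ℝ) + 2)
      = ∫ u, (2 * (1 - 2 * u) ^ (a + 2 * d) + 2 * (1 - 2 * u) ^ (a + 2 * d + 1)) ∂unitMeasure := by
    rw [unitMeasure, ← integral_Ioc_eq_integral_Ioo,
      ← intervalIntegral.integral_of_le zero_le_one,
      intervalIntegral.integral_add (Continuous.intervalIntegrable (by fun_prop) _ _)
        (Continuous.intervalIntegrable (by fun_prop) _ _), intervalIntegral.integral_const_mul,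
      intervalIntegral.integral_const_mul, integral_one_sub_two_mul_pow,
      integral_one_sub_two_mul_pow]
    push_cast
    field_simp
    ring
  have h2 : Integrable (fun u : ℝ => 2 * (1 - 2 * u) ^ (a + 2 * d)
      + 2 * (1 - 2 * u) ^ (a + 2 * d + 1)) unitMeasure :=
    ((Continuous.integrableOn_Icc (a := 0) (b := 1) (by fun_prop)).mono_set Set.Ioo_subset_Icc_self)
  rw [h1, harmonicKernel, harmonicKernel, ← integral_add (integrable_inv_mul_pow_sub_pow a d) h2]
  refine integral_congr_ae ?_
  filter_upwards [ae_restrict_mem measurableSet_Ioo] with u hu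
  have hu0 := hu.1.ne'
  field_simp
  ring

/-- Exactly one of `a+2d+1` and `a+2d+2` is odd, and the increment is `2` divided by that one. -/
theorem harmonicKernel_succ_bounds (a d : ℕ) :
    2 / ((a + 2 * d : ℝ) + 2) ≤ harmonicKernel a (d + 1) - harmonicKernel a d ∧
    harmonicKernel a (d + 1) - harmonicKernel a d ≤ 2 / ((a + 2 * d : ℝ) + 1) := by
  rw [harmonicKernel_succ, add_sub_cancel_left]
  have h : 2 / ((a + 2 * d : ℝ) + 2) ≤ 2 / ((a + 2 * d : ℝ) + 1) := by
    gcongr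
    norm_num
  rcases Nat.even_or_odd (a + 2 * d) with he | ho
  · rw [(he.add_one).neg_one_pow, (he.add even_two).neg_one_pow]
    norm_num at h ⊢
    exact h
  · rw [(ho.add_one).neg_one_pow, (ho.add_even even_two).neg_one_pow]
    norm_num at h ⊢
    exact h

/-- Compares each increment with a logarithm through `log(1+x) ≤ x`, where `x = 2/(a+2d+2)`. -/
theorem le_harmonicKernel (a d : ℕ) :
    Real.log ((a + 2 * d + 2 : ℝ) / (a + 2)) ≤ harmonicKernel a d := by
  induction d with
  | zero =>
    rw [harmonicKernel_zero]
    simp [div_self (by positivity : (a : ℝ) + 2 ≠ 0)]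
  | succ d ih =>
    have h1 := (harmonicKernel_succ_bounds a d).1
    have hx : (0 : ℝ) < (a + 2 * d : ℝ) + 2 := by positivity
    have h2 : Real.log ((a + 2 * (d + 1 : ℕ) + 2 : ℝ) / (a + 2))
        = Real.log (((a + 2 * d : ℝ) + 2) / (a + 2))
          + Real.log (1 + 2 / ((a + 2 * d : ℝ) + 2)) := by
      rw [← Real.log_mul (by positivity) (by positivity)]
      congr 1
      push_cast
      field_simp
      ring
    have h3 := Real.log_le_sub_one_of_pos (x := 1 + 2 / ((a + 2 * d : ℝ) + 2)) (by positivity)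
    linarith

theorem harmonicKernel_le (a d : ℕ) :
    harmonicKernel a d ≤ 2 / ((a : ℝ) + 1) + Real.log ((a + 2 * d + 1 : ℝ) / (a + 1)) := by
  -- Subtracting `2/(a+2d+1)` makes the bound inductive: this term absorbs the next increment, and
  -- `log(1-x) ≤ -x` with `x = 2/(a+2d+3)` restores it at `d+1`. At `d = 0` it cancels `2/(a+1)`.
  suffices h : harmonicKernel a d ≤ 2 / ((a : ℝ) + 1) + Real.log ((a + 2 * d + 1 : ℝ) / (a + 1))
      - 2 / ((a + 2 * d : ℝ) + 1) by
    have : 0 ≤ 2 / ((a + 2 * d : ℝ) + 1) := by positivity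
    linarith
  induction d with
  | zero =>
    rw [harmonicKernel_zero]
    simp [div_self (by positivity : (a : ℝ) + 1 ≠ 0)]
  | succ d ih =>
    have h1 := (harmonicKernel_succ_bounds a d).2
    have h2 : Real.log ((a + 2 * (d + 1 : ℕ) + 1 : ℝ) / (a + 1))
        = Real.log (((a + 2 * d : ℝ) + 1) / (a + 1))
          - Real.log (1 - 2 / ((a + 2 * d : ℝ) + 3)) := by
      have h4 : 1 - 2 / ((a + 2 * d : ℝ) + 3) = (a + 2 * d + 1) / (a + 2 * d + 3) := by
        field_simp
        ring
      rw [h4, ← Real.log_div (by positivity) (by positivity)]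
      congr 1
      push_cast
      field_simp
      ring
    have h3 := Real.log_le_sub_one_of_pos (x := 1 - 2 / ((a + 2 * d : ℝ) + 3)) (by
      rw [sub_pos, div_lt_one (by positivity)]
      have : (0 : ℝ) ≤ a + 2 * d := by positivity
      linarith)
    have h5 : 2 / ((a + 2 * (d + 1 : ℕ) : ℝ) + 1) = 2 / ((a + 2 * d : ℝ) + 3) := by
      congr 1; push_cast; ring
    rw [h5]
    linarith

/-- The weighted mean of the covariance kernel of the signs. -/
def covKernel (j k : ℕ) : ℝ := ∫ u, u⁻¹ * signKernel u j k ∂unitMeasure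

theorem covKernel_eq (j k : ℕ) :
    covKernel j k = harmonicKernel (max j k - min j k) (min j k) := by
  simp only [covKernel, harmonicKernel, signKernel, ← add_eq_sub_add_two_mul]

theorem cast_max_sub_min (j k : ℕ) : ((max j k - min j k : ℕ) : ℝ) = |(j : ℝ) - k| := by
  rcases le_total j k with h | h
  · rw [max_eq_right h, min_eq_left h, Nat.cast_sub h, abs_sub_comm, abs_of_nonneg]
    rwa [sub_nonneg, Nat.cast_le]
  · rw [max_eq_left h, min_eq_right h, Nat.cast_sub h, abs_of_nonneg]
    rwa [sub_nonneg, Nat.cast_le]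

theorem cast_add_eq (j k : ℕ) : |(j : ℝ) - k| + 2 * (min j k : ℕ) = j + k := by
  rw [← cast_max_sub_min]
  exact_mod_cast (add_eq_sub_add_two_mul j k).symm

theorem le_covKernel (j k : ℕ) :
    Real.log ((j + k + 2 : ℝ) / (|(j : ℝ) - k| + 2)) ≤ covKernel j k := by
  have h := le_harmonicKernel (max j k - min j k) (min j k)
  rwa [← covKernel_eq, cast_max_sub_min, cast_add_eq] at h

theorem covKernel_le (j k : ℕ) : covKernel j k ≤ 2 / (|(j : ℝ) - k| + 1)
    + Real.log ((j + k + 1 : ℝ) / (|(j : ℝ) - k| + 1)) := by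
  have h := harmonicKernel_le (max j k - min j k) (min j k)
  rwa [← covKernel_eq, cast_max_sub_min, cast_add_eq] at h

theorem covKernel_nonneg (j k : ℕ) : 0 ≤ covKernel j k := by
  refine (Real.log_nonneg ?_).trans (le_covKernel j k)
  rw [one_le_div (by positivity)]
  have : |(j : ℝ) - k| ≤ j + k := by
    rw [abs_le]; constructor <;> linarith [Nat.cast_nonneg (α := ℝ) j, Nat.cast_nonneg (α := ℝ) k]
  linarith

/-! ### Discretization -/

section Discretization

variable {s t : ℝ}

theorem abs_sub_le_ceil (hs : 0 < s) (ht : 0 < t) : |s - t| ≤ |(⌈s⌉₊ : ℝ) - ⌈t⌉₊| + 1 := by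
  have h1 := Nat.le_ceil s
  have h2 := Nat.ceil_lt_add_one hs.le
  have h3 := Nat.le_ceil t
  have h4 := Nat.ceil_lt_add_one ht.le
  have h5 := neg_abs_le ((⌈s⌉₊ : ℝ) - ⌈t⌉₊)
  have h6 := le_abs_self ((⌈s⌉₊ : ℝ) - ⌈t⌉₊)
  rw [abs_le]
  constructor <;> linarith

/-- Rounding changes the difference by at most `1`, which the `+1` in the denominator of
`covKernel_le` absorbs. In the numerator the rounding costs at most `3 ≤ 3n`, so `n` cancels and the
bound is uniform in `n`. -/
theorem covKernel_ceil_le {n : ℕ} (hn : 0 < n) (hs : 0 < s) (ht : 0 < t) (hst : s ≠ t) :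
    covKernel ⌈n * s⌉₊ ⌈n * t⌉₊ ≤ logMajorant (s, t) := by
  have hn0 : (0 : ℝ) < n := by exact_mod_cast hn
  have hn1 : (1 : ℝ) ≤ n := by exact_mod_cast hn
  have hab := abs_pos.2 (sub_ne_zero.2 hst)
  refine (covKernel_le _ _).trans (add_le_add ?_ (Real.log_le_log (by positivity) ?_))
  · rw [div_le_iff₀ (by positivity)]
    linarith [abs_nonneg ((⌈n * s⌉₊ : ℝ) - ⌈n * t⌉₊)]
  · have h1 := abs_sub_le_ceil (mul_pos hn0 hs) (mul_pos hn0 ht)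
    rw [← mul_sub, abs_mul, abs_of_pos hn0] at h1
    have h2 := Nat.ceil_lt_add_one (mul_pos hn0 hs).le
    have h3 := Nat.ceil_lt_add_one (mul_pos hn0 ht).le
    calc ((⌈n * s⌉₊ : ℝ) + ⌈n * t⌉₊ + 1) / (|(⌈n * s⌉₊ : ℝ) - ⌈n * t⌉₊| + 1)
        ≤ (n * (s + t + 3)) / (n * |s - t|) := by
          gcongr
          nlinarith
      _ = (s + t + 3) / |s - t| := mul_div_mul_left _ _ hn0.ne'

theorem tendsto_ceil_mul_div (hs : 0 < s) :
    Tendsto (fun n : ℕ => (⌈(n : ℝ) * s⌉₊ : ℝ) / n) atTop (𝓝 s) := by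
  have h := (tendsto_nat_ceil_mul_div_atTop hs.le).comp (tendsto_natCast_atTop_atTop (R := ℝ))
  refine h.congr fun n => ?_
  simp [mul_comm]

/-- The additive constants in the two logarithmic bounds disappear after dividing numerator and
denominator by `n`, so both sides have the same limit off the diagonal. -/
theorem tendsto_covKernel_ceil (hs : 0 < s) (ht : 0 < t) (hst : s ≠ t) :
    Tendsto (fun n : ℕ => covKernel ⌈(n : ℝ) * s⌉₊ ⌈(n : ℝ) * t⌉₊) atTop
      (𝓝 (Real.log ((s + t) / |s - t|))) := by
  have hab := abs_pos.2 (sub_ne_zero.2 hst)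
  have hadd : ∀ c : ℝ, Tendsto (fun n : ℕ => ((⌈(n : ℝ) * s⌉₊ : ℝ) + ⌈(n : ℝ) * t⌉₊ + c) / n) atTop
      (𝓝 (s + t)) := by
    intro c
    have := ((tendsto_ceil_mul_div hs).add (tendsto_ceil_mul_div ht)).add
      (tendsto_const_div_atTop_nhds_zero_nat c)
    rw [add_zero] at this
    exact this.congr fun n => by ring
  have hsub : ∀ c : ℝ, Tendsto (fun n : ℕ => (|(⌈(n : ℝ) * s⌉₊ : ℝ) - ⌈(n : ℝ) * t⌉₊| + c) / n)
      atTop (𝓝 |s - t|) := by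
    intro c
    have := (((tendsto_ceil_mul_div hs).sub (tendsto_ceil_mul_div ht)).abs).add
      (tendsto_const_div_atTop_nhds_zero_nat c)
    rw [add_zero] at this
    refine this.congr fun n => ?_
    rw [← sub_div, abs_div, Nat.abs_cast]
    ring
  have hlog : ∀ c d : ℝ, Tendsto (fun n : ℕ => Real.log (((⌈(n : ℝ) * s⌉₊ : ℝ) + ⌈(n : ℝ) * t⌉₊ + c) /
      (|(⌈(n : ℝ) * s⌉₊ : ℝ) - ⌈(n : ℝ) * t⌉₊| + d))) atTop
      (𝓝 (Real.log ((s + t) / |s - t|))) := by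
    intro c d
    have h1 := ((hadd c).div (hsub d) hab.ne').log (div_pos (by linarith) hab).ne'
    refine h1.congr' ?_
    filter_upwards [eventually_gt_atTop 0] with n hn
    simp only [Pi.div_apply]
    rw [div_div_div_cancel_right₀ (by positivity)]
  have hinv : Tendsto (fun n : ℕ => 2 / (|(⌈(n : ℝ) * s⌉₊ : ℝ) - ⌈(n : ℝ) * t⌉₊| + 1)) atTop
      (𝓝 0) := by
    have h1 := (tendsto_const_div_atTop_nhds_zero_nat 2).div (hsub 1) hab.ne'
    rw [zero_div] at h1
    refine h1.congr' ?_
    filter_upwards [eventually_gt_atTop 0] with n hn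
    simp only [Pi.div_apply]
    rw [div_div_div_cancel_right₀ (by positivity)]
  have hup := hinv.add (hlog 1 1)
  rw [zero_add] at hup
  exact tendsto_of_tendsto_of_tendsto_of_le_of_le (hlog 2 2) hup
    (fun n => le_covKernel _ _) (fun n => covKernel_le _ _)

end Discretization

/-! ### A weighted bound for the kernel -/

/-- The integral is split at `u = 1/j`, where the two bounds on the kernel exchange roles. Below,
`4j u^{-κ}` is integrable since `κ < 1`; above, `u^{-1-κ}` is integrable at infinity since `κ > 0`.
Both pieces are of order `j^κ`. -/
theorem integral_weight_signKernel {κ : ℝ} (hκ : 0 < κ) (hκ1 : κ < 1) (j k : ℕ) :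
    Integrable (fun u => u ^ (-1 - κ) * |signKernel u j k|) unitMeasure ∧
    ∫ u, u ^ (-1 - κ) * |signKernel u j k| ∂unitMeasure ≤ (4 / (1 - κ) + 1 / κ) * (j : ℝ) ^ κ := by
  rcases Nat.eq_zero_or_pos j with rfl | hj
  · have h0 : ∀ u, signKernel u 0 k = 0 := fun u => by simp [signKernel]
    have h1 : 0 < 1 - κ := by linarith
    simp only [h0, abs_zero, mul_zero, integral_zero]
    exact ⟨integrable_zero _ _ _, by positivity⟩
  have hj0 : (0 : ℝ) < j := by exact_mod_cast hj
  have hc : (0 : ℝ) < (j : ℝ)⁻¹ := by positivity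
  set G1 : ℝ → ℝ := (Set.Ioc (0 : ℝ) (j : ℝ)⁻¹).indicator fun u => 4 * j * u ^ (-κ) with hG1
  set G2 : ℝ → ℝ := (Set.Ioi (j : ℝ)⁻¹).indicator fun u => u ^ (-1 - κ) with hG2
  have i1' : IntegrableOn (fun u : ℝ => 4 * j * u ^ (-κ)) (Set.Ioc (0 : ℝ) (j : ℝ)⁻¹) := by
    refine Integrable.const_mul ?_ _
    exact (intervalIntegrable_iff_integrableOn_Ioc_of_le hc.le).1
      (intervalIntegral.intervalIntegrable_rpow' (by linarith))
  have i1 : Integrable G1 volume := i1'.integrable_indicator measurableSet_Ioc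
  have i2 : Integrable G2 volume :=
    (integrableOn_Ioi_rpow_of_lt (by linarith) hc).integrable_indicator measurableSet_Ioi
  have hn1 : ∀ u, 0 ≤ G1 u := fun u => Set.indicator_nonneg
    (fun x hx => by have := hx.1; positivity) u
  have hn2 : ∀ u, 0 ≤ G2 u := fun u => Set.indicator_nonneg
    (fun x hx => Real.rpow_nonneg (hc.trans hx).le _) u
  have hle : ∀ᵐ u ∂unitMeasure, u ^ (-1 - κ) * |signKernel u j k| ≤ G1 u + G2 u := by
    filter_upwards [ae_restrict_mem measurableSet_Ioo] with u hu
    have hk := abs_signKernel_le hu j k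
    have hp : 0 ≤ u ^ (-1 - κ) := Real.rpow_nonneg hu.1.le _
    by_cases hu2 : u ≤ (j : ℝ)⁻¹
    · have : G1 u = 4 * j * u ^ (-κ) := Set.indicator_of_mem (by exact ⟨hu.1, hu2⟩) _
      have h2 : u ^ (-1 - κ) * (4 * u * j) = G1 u := by
        have h3 : u ^ (-κ) = u ^ (-1 - κ) * u := by
          rw [← Real.rpow_add_one hu.1.ne']; congr 1; ring
        rw [this, h3]; ring
      calc u ^ (-1 - κ) * |signKernel u j k| ≤ u ^ (-1 - κ) * (4 * u * j) := by
            gcongr; exact hk.trans (min_le_right _ _)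
        _ ≤ _ := by rw [h2]; linarith [hn2 u]
    · have : G2 u = u ^ (-1 - κ) := Set.indicator_of_mem (by exact not_le.1 hu2) _
      calc u ^ (-1 - κ) * |signKernel u j k| ≤ u ^ (-1 - κ) * 1 := by
            gcongr; exact hk.trans (min_le_left _ _)
        _ ≤ _ := by rw [mul_one, this]; linarith [hn1 u]
  have hm : AEStronglyMeasurable (fun u => u ^ (-1 - κ) * |signKernel u j k|) unitMeasure := by
    have := measurable_signKernel j k
    exact Measurable.aestronglyMeasurable (by fun_prop)
  have hi : Integrable (fun u => u ^ (-1 - κ) * |signKernel u j k|) unitMeasure := by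
    refine Integrable.mono' ((i1.add i2).mono_measure Measure.restrict_le_self) hm ?_
    filter_upwards [hle, ae_restrict_mem measurableSet_Ioo] with u hu hu2
    rw [Real.norm_of_nonneg (mul_nonneg (Real.rpow_nonneg hu2.1.le _) (abs_nonneg _))]
    exact hu
  refine ⟨hi, ?_⟩
  have hI1 : ∫ u, G1 u = 4 / (1 - κ) * (j : ℝ) ^ κ := by
    rw [hG1, integral_indicator measurableSet_Ioc, integral_const_mul,
      ← intervalIntegral.integral_of_le hc.le, integral_rpow (Or.inl (by linarith)),
      Real.zero_rpow (by linarith), Real.inv_rpow hj0.le, ← Real.rpow_neg hj0.le,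
      show -(-κ + 1) = κ - 1 by ring, Real.rpow_sub_one hj0.ne']
    have : 1 - κ ≠ 0 := by linarith
    have : -κ + 1 ≠ 0 := by linarith
    field_simp
    ring
  have hI2 : ∫ u, G2 u = 1 / κ * (j : ℝ) ^ κ := by
    rw [hG2, integral_indicator measurableSet_Ioi, integral_Ioi_rpow_of_lt (by linarith) hc,
      show -1 - κ + 1 = -κ by ring, Real.inv_rpow hj0.le, Real.rpow_neg hj0.le, inv_inv]
    field_simp
  calc ∫ u, u ^ (-1 - κ) * |signKernel u j k| ∂unitMeasure
      ≤ ∫ u, (G1 u + G2 u) ∂unitMeasure :=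
        integral_mono_ae hi ((i1.add i2).mono_measure Measure.restrict_le_self) hle
    _ ≤ ∫ u, (G1 u + G2 u) := integral_mono_measure Measure.restrict_le_self
        (ae_of_all _ fun u => add_nonneg (hn1 u) (hn2 u)) (i1.add i2)
    _ = _ := by rw [integral_add i1 i2, hI1, hI2]; ring

/-! ### Convergence of the prelimit variance -/

section Variance

variable {δ : ℝ} {f : ℝ → ℝ}

/-- The variance of `G_n(f)`. -/
def aggregatedVariance (f : ℝ → ℝ) (n : ℕ) : ℝ :=
  ∫ z, f z.1 * f z.2 * covKernel ⌈n * z.1⌉₊ ⌈n * z.2⌉₊ ∂quadrantMeasure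

theorem measurable_comp_ceil {E : Type*} [MeasurableSpace E] (n : ℕ) (c : ℕ → ℕ → E) :
    Measurable fun z : ℝ × ℝ => c ⌈n * z.1⌉₊ ⌈n * z.2⌉₊ := by
  have h1 : Measurable fun p : ℕ × ℕ => c p.1 p.2 := measurable_of_countable _
  have h2 : Measurable fun z : ℝ × ℝ => (⌈n * z.1⌉₊, ⌈n * z.2⌉₊) := by fun_prop
  exact h1.comp h2

theorem tendsto_aggregatedVariance (hδ : 0 < δ) (hf : f ∈ TestClass δ) :
    Tendsto (aggregatedVariance f) atTop (𝓝 (∫ z, logIntegrand f f z ∂quadrantMeasure)) := by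
  have hff := ((TestClass.integrable hδ.le hf).mul_prod
    (TestClass.integrable hδ.le hf)).aestronglyMeasurable
  refine tendsto_integral_filter_of_dominated_convergence _ (Eventually.of_forall fun n => ?_) ?_
    (integrable_mul_logMajorant hδ hf hf) ?_
  · exact hff.mul (measurable_comp_ceil n covKernel).aestronglyMeasurable
  · filter_upwards [eventually_gt_atTop 0] with n hn
    filter_upwards [ae_quadrant_ne, ae_quadrant (p := fun z => 0 < z.1 ∧ 0 < z.2)
      fun s t hs ht => ⟨hs, ht⟩] with z hz hpos
    rw [Real.norm_eq_abs, abs_mul, abs_mul, abs_of_nonneg (covKernel_nonneg _ _)]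
    gcongr
    exact covKernel_ceil_le hn hpos.1 hpos.2 hz
  · filter_upwards [ae_quadrant_ne, ae_quadrant (p := fun z => 0 < z.1 ∧ 0 < z.2)
      fun s t hs ht => ⟨hs, ht⟩] with z hz hpos
    exact (tendsto_covKernel_ceil hpos.1 hpos.2 hz).const_mul _

/-- The variance of a layer of `G_n(f)`, conditionally on its Bernoulli parameter `u`, up to the
factor `u⁻¹`. -/
def layerVariance (f : ℝ → ℝ) (n : ℕ) (u : ℝ) : ℝ :=
  ∫ z, f z.1 * f z.2 * signKernel u ⌈(n : ℝ) * z.1⌉₊ ⌈(n : ℝ) * z.2⌉₊ ∂quadrantMeasure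

theorem measurable_signKernel_ceil (n : ℕ) :
    Measurable fun p : ℝ × (ℝ × ℝ) => signKernel p.1 ⌈n * p.2.1⌉₊ ⌈n * p.2.2⌉₊ := by
  have h1 : Measurable fun p : (ℕ × ℕ) × ℝ => signKernel p.2 p.1.1 p.1.2 :=
    measurable_from_prod_countable_right fun p => measurable_signKernel p.1 p.2
  have h2 : Measurable fun p : ℝ × (ℝ × ℝ) => ((⌈n * p.2.1⌉₊, ⌈n * p.2.2⌉₊), p.1) := by fun_prop
  exact h1.comp h2

theorem stronglyMeasurable_layerVariance (hf : AEStronglyMeasurable f halfLine) (n : ℕ) :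
    StronglyMeasurable (layerVariance f n) := by
  have hff : AEStronglyMeasurable (fun z : ℝ × ℝ => f z.1 * f z.2) quadrantMeasure :=
    hf.comp_fst.mul hf.comp_snd
  have h : layerVariance f n = fun u => ∫ z, hff.mk _ z *
      signKernel u ⌈(n : ℝ) * z.1⌉₊ ⌈(n : ℝ) * z.2⌉₊ ∂quadrantMeasure := by
    funext u
    refine integral_congr_ae ?_
    filter_upwards [hff.ae_eq_mk] with z hz
    rw [← hz]
  rw [h]
  exact StronglyMeasurable.integral_prod_right (f := fun (u : ℝ) (z : ℝ × ℝ) => hff.mk _ z *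
    signKernel u ⌈(n : ℝ) * z.1⌉₊ ⌈(n : ℝ) * z.2⌉₊)
    ((hff.stronglyMeasurable_mk.measurable.comp measurable_snd).mul
      (measurable_signKernel_ceil n)).stronglyMeasurable

theorem abs_layerVariance_le (hf : Integrable f halfLine) (n : ℕ) {u : ℝ}
    (hu : u ∈ Set.Ioo (0 : ℝ) 1) : |layerVariance f n u| ≤ (∫ t, |f t| ∂halfLine) ^ 2 := by
  have hff : Integrable (fun z : ℝ × ℝ => |f z.1| * |f z.2|) quadrantMeasure :=
    hf.norm.mul_prod hf.norm
  have h1 : ∫ z, |f z.1| * |f z.2| ∂quadrantMeasure = (∫ t, |f t| ∂halfLine) ^ 2 := by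
    rw [sq]
    exact integral_prod_mul (fun t => |f t|) (fun t => |f t|)
  rw [← h1, ← Real.norm_eq_abs]
  refine norm_integral_le_of_norm_le hff (ae_of_all _ fun z => ?_)
  rw [Real.norm_eq_abs, abs_mul, abs_mul]
  exact mul_le_of_le_one_right (by positivity)
    ((abs_signKernel_le hu _ _).trans (min_le_left _ _))

/-- Fubini's theorem for weighted integrals of `layerVariance`. -/
theorem integral_weight_layerVariance (hf : AEStronglyMeasurable f halfLine) (n : ℕ) {h : ℝ → ℝ}
    (hm : Measurable h) (h0 : ∀ u ∈ Set.Ioo (0 : ℝ) 1, 0 ≤ h u)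
    (hi : ∀ j k, Integrable (fun u => h u * |signKernel u j k|) unitMeasure)
    {b : ℝ × ℝ → ℝ} (hb : Integrable b quadrantMeasure)
    (hle : ∀ᵐ z ∂quadrantMeasure, |f z.1| * |f z.2| *
      ∫ u, h u * |signKernel u ⌈(n : ℝ) * z.1⌉₊ ⌈(n : ℝ) * z.2⌉₊| ∂unitMeasure ≤ b z) :
    Integrable (fun u => h u * layerVariance f n u) unitMeasure ∧
    ∫ u, h u * layerVariance f n u ∂unitMeasure = ∫ z, f z.1 * f z.2 *
      ∫ u, h u * signKernel u ⌈(n : ℝ) * z.1⌉₊ ⌈(n : ℝ) * z.2⌉₊ ∂unitMeasure ∂quadrantMeasure ∧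
    |∫ u, h u * layerVariance f n u ∂unitMeasure| ≤ ∫ z, b z ∂quadrantMeasure := by
  have hff : AEStronglyMeasurable (fun z : ℝ × ℝ => f z.1 * f z.2) quadrantMeasure :=
    hf.comp_fst.mul hf.comp_snd
  have hmeas : AEStronglyMeasurable (fun p : ℝ × (ℝ × ℝ) => h p.1 * (f p.2.1 * f p.2.2 *
      signKernel p.1 ⌈n * p.2.1⌉₊ ⌈n * p.2.2⌉₊)) (unitMeasure.prod quadrantMeasure) :=
    (hm.comp measurable_fst).aestronglyMeasurable.mul
      (hff.comp_snd.mul (measurable_signKernel_ceil n).aestronglyMeasurable)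
  have hnorm : ∀ z : ℝ × ℝ, ∫ u, ‖h u * (f z.1 * f z.2 *
      signKernel u ⌈(n : ℝ) * z.1⌉₊ ⌈(n : ℝ) * z.2⌉₊)‖ ∂unitMeasure = |f z.1| * |f z.2| *
      ∫ u, h u * |signKernel u ⌈(n : ℝ) * z.1⌉₊ ⌈(n : ℝ) * z.2⌉₊| ∂unitMeasure := by
    intro z
    rw [← integral_const_mul]
    refine integral_congr_ae ?_
    filter_upwards [ae_restrict_mem measurableSet_Ioo] with u hu
    rw [Real.norm_eq_abs, abs_mul, abs_mul, abs_mul, abs_of_nonneg (h0 u hu)]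
    ring
  have hs : ∀ j k, Integrable (fun u => h u * signKernel u j k) unitMeasure := by
    intro j k
    refine (hi j k).mono (hm.mul (measurable_signKernel j k)).aestronglyMeasurable
      (ae_of_all _ fun u => ?_)
    simp
  have hint : Integrable (fun p : ℝ × (ℝ × ℝ) => h p.1 * (f p.2.1 * f p.2.2 *
      signKernel p.1 ⌈n * p.2.1⌉₊ ⌈n * p.2.2⌉₊)) (unitMeasure.prod quadrantMeasure) := by
    refine (integrable_prod_iff' hmeas).2 ⟨ae_of_all _ fun z => ?_, ?_⟩
    · refine ((hs ⌈n * z.1⌉₊ ⌈n * z.2⌉₊).const_mul (f z.1 * f z.2)).congr (ae_of_all _ fun u => ?_)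
      ring
    · simp only [hnorm]
      refine hb.mono' ?_ ?_
      · exact (hf.norm.comp_fst.mul hf.norm.comp_snd).mul (measurable_comp_ceil n
          fun j k => ∫ u, h u * |signKernel u j k| ∂unitMeasure).aestronglyMeasurable
      · filter_upwards [hle] with z hz
        refine (Real.norm_of_nonneg ?_).trans_le hz
        refine mul_nonneg (by positivity) (integral_nonneg_of_ae ?_)
        filter_upwards [ae_restrict_mem measurableSet_Ioo] with u hu
        exact mul_nonneg (h0 u hu) (abs_nonneg _)
  have heq : ∀ u, h u * layerVariance f n u = ∫ z, h u * (f z.1 * f z.2 *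
      signKernel u ⌈(n : ℝ) * z.1⌉₊ ⌈(n : ℝ) * z.2⌉₊) ∂quadrantMeasure := fun u => by
    rw [integral_const_mul, layerVariance]
  have hswap : ∫ u, h u * layerVariance f n u ∂unitMeasure = ∫ z, f z.1 * f z.2 *
      ∫ u, h u * signKernel u ⌈(n : ℝ) * z.1⌉₊ ⌈(n : ℝ) * z.2⌉₊ ∂unitMeasure ∂quadrantMeasure := by
    simp_rw [heq]
    rw [integral_integral_swap hint]
    refine integral_congr_ae (ae_of_all _ fun z => ?_)
    simp only
    rw [← integral_const_mul]
    refine integral_congr_ae (ae_of_all _ fun u => ?_)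
    ring
  refine ⟨?_, hswap, ?_⟩
  · simp_rw [heq]
    exact hint.integral_prod_left
  · rw [hswap, ← Real.norm_eq_abs]
    refine norm_integral_le_of_norm_le hb ?_
    filter_upwards [hle] with z hz
    refine le_trans ?_ hz
    rw [Real.norm_eq_abs, abs_mul, abs_mul]
    gcongr
    rw [← Real.norm_eq_abs]
    refine norm_integral_le_of_norm_le (hi _ _) ?_
    filter_upwards [ae_restrict_mem measurableSet_Ioo] with u hu
    rw [Real.norm_eq_abs, abs_mul, abs_of_nonneg (h0 u hu)]

/-- One statement serves the weight `u⁻¹` of the variance and the weight `u^{-1-κ}` of the error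
term. The growth `j^κ` at `j = ⌈ns⌉ ≤ n(1+s)` becomes `n^κ (1+s)^κ`, integrable against `|f|`
because `κ ≤ δ`. -/
theorem integral_rpow_layerVariance {κ : ℝ} (hκ : 0 < κ) (hκ1 : κ < 1) (hκδ : κ ≤ δ)
    (hf : f ∈ TestClass δ) {n : ℕ} (hn : 0 < n) {h : ℝ → ℝ} (hm : Measurable h)
    (h0 : ∀ u ∈ Set.Ioo (0 : ℝ) 1, 0 ≤ h u) (hle : ∀ u ∈ Set.Ioo (0 : ℝ) 1, h u ≤ u ^ (-1 - κ)) :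
    Integrable (fun u => h u * layerVariance f n u) unitMeasure ∧
    ∫ u, h u * layerVariance f n u ∂unitMeasure = ∫ z, f z.1 * f z.2 *
      ∫ u, h u * signKernel u ⌈(n : ℝ) * z.1⌉₊ ⌈(n : ℝ) * z.2⌉₊ ∂unitMeasure ∂quadrantMeasure ∧
    |∫ u, h u * layerVariance f n u ∂unitMeasure| ≤
      (4 / (1 - κ) + 1 / κ) * (n : ℝ) ^ κ *
        ((∫ s, (1 + s) ^ κ * |f s| ∂halfLine) * ∫ t, |f t| ∂halfLine) := by
  have hfi := TestClass.integrable (hκ.le.trans hκδ) hf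
  have hκ2 : 0 < 1 - κ := by linarith
  have hn1 : (1 : ℝ) ≤ n := by exact_mod_cast hn
  have hi : ∀ j k, Integrable (fun u => h u * |signKernel u j k|) unitMeasure ∧
      ∫ u, h u * |signKernel u j k| ∂unitMeasure ≤ (4 / (1 - κ) + 1 / κ) * (j : ℝ) ^ κ := by
    intro j k
    have hw := integral_weight_signKernel hκ hκ1 j k
    have hle' : ∀ᵐ u ∂unitMeasure,
        h u * |signKernel u j k| ≤ u ^ (-1 - κ) * |signKernel u j k| := by
      filter_upwards [ae_restrict_mem measurableSet_Ioo] with u hu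
      gcongr
      exact hle u hu
    have hi' : Integrable (fun u => h u * |signKernel u j k|) unitMeasure := by
      refine hw.1.mono' (hm.mul (measurable_signKernel j k).abs).aestronglyMeasurable ?_
      filter_upwards [hle', ae_restrict_mem measurableSet_Ioo] with u hu hu2
      rwa [Real.norm_of_nonneg (mul_nonneg (h0 u hu2) (abs_nonneg _))]
    exact ⟨hi', (integral_mono_ae hi' hw.1 hle').trans hw.2⟩
  have hbi := (TestClass.integrable_weight hf hκ.le hκδ).mul_prod hfi.norm
  have hle : ∀ᵐ z ∂quadrantMeasure, |f z.1| * |f z.2| *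
      ∫ u, h u * |signKernel u ⌈(n : ℝ) * z.1⌉₊ ⌈(n : ℝ) * z.2⌉₊| ∂unitMeasure ≤
      (4 / (1 - κ) + 1 / κ) * (n : ℝ) ^ κ * (((1 + z.1) ^ κ * |f z.1|) * ‖f z.2‖) := by
    refine ae_quadrant fun s t hs ht => ?_
    have h1 := (hi ⌈(n : ℝ) * s⌉₊ ⌈(n : ℝ) * t⌉₊).2
    have h2 : ((⌈(n : ℝ) * s⌉₊ : ℕ) : ℝ) ^ κ ≤ (n : ℝ) ^ κ * (1 + s) ^ κ := by
      rw [← Real.mul_rpow (by positivity) (by positivity)]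
      gcongr
      have := Nat.ceil_lt_add_one (a := (n : ℝ) * s) (by positivity)
      nlinarith
    have h3 : ∫ u, h u * |signKernel u ⌈(n : ℝ) * s⌉₊ ⌈(n : ℝ) * t⌉₊| ∂unitMeasure ≤
        (4 / (1 - κ) + 1 / κ) * ((n : ℝ) ^ κ * (1 + s) ^ κ) :=
      h1.trans (mul_le_mul_of_nonneg_left h2 (by positivity))
    refine (mul_le_mul_of_nonneg_left h3 (by positivity)).trans_eq ?_
    rw [Real.norm_eq_abs]
    ring
  have hw := integral_weight_layerVariance hfi.aestronglyMeasurable n hm h0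
    (fun j k => (hi j k).1) (hbi.const_mul _) hle
  refine ⟨hw.1, hw.2.1, hw.2.2.trans_eq ?_⟩
  rw [integral_const_mul]
  congr 1
  exact integral_prod_mul (fun s => (1 + s) ^ κ * |f s|) (fun t => |f t|)

theorem integral_inv_layerVariance {κ : ℝ} (hκ : 0 < κ) (hκ1 : κ < 1) (hκδ : κ ≤ δ)
    (hf : f ∈ TestClass δ) {n : ℕ} (hn : 0 < n) :
    Integrable (fun u => u⁻¹ * layerVariance f n u) unitMeasure ∧
    ∫ u, u⁻¹ * layerVariance f n u ∂unitMeasure = aggregatedVariance f n := by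
  have h := integral_rpow_layerVariance hκ hκ1 hκδ hf hn (h := fun u => u⁻¹) (by fun_prop)
    (fun u hu => inv_nonneg.2 hu.1.le) (fun u hu => by
      rw [← Real.rpow_neg_one]
      exact Real.rpow_le_rpow_of_exponent_ge hu.1 hu.2.le (by linarith))
  exact ⟨h.1, h.2.1⟩

end Variance

/-! ### Conditional expectation and nonnegative weights -/

/-- Pulls out an unbounded factor `h`, with integrability of `h W` part of the conclusion. The
measures with densities `W` and `E[W | m]` agree on `m`, hence integrate nonnegative `m`-measurable
functions alike. -/
theorem integral_mul_condExp {Ω : Type*} {m m0 : MeasurableSpace Ω} {P : Measure Ω}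
    [IsFiniteMeasure P] (hm : m ≤ m0) {W h : Ω → ℝ} (hW : Integrable W P) (hW0 : 0 ≤ᵐ[P] W)
    (hh : Measurable[m] h) (hh0 : 0 ≤ᵐ[P] h) (hi : Integrable (fun ω => h ω * (P[W | m]) ω) P) :
    Integrable (fun ω => h ω * W ω) P ∧ ∫ ω, h ω * W ω ∂P = ∫ ω, h ω * (P[W | m]) ω ∂P := by
  have hE0 : 0 ≤ᵐ[P] P[W | m] := condExp_nonneg hW0
  have key : ∫⁻ ω, ENNReal.ofReal (W ω) * ENNReal.ofReal (h ω) ∂P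
      = ∫⁻ ω, ENNReal.ofReal ((P[W | m]) ω) * ENNReal.ofReal (h ω) ∂P := by
    have hmeas : (P.withDensity fun ω => ENNReal.ofReal (W ω)).trim hm
        = (P.withDensity fun ω => ENNReal.ofReal ((P[W | m]) ω)).trim hm := by
      refine @Measure.ext _ m _ _ fun s hs => ?_
      rw [trim_measurableSet_eq hm hs, trim_measurableSet_eq hm hs,
        withDensity_apply _ (hm s hs), withDensity_apply _ (hm s hs),
        ← ofReal_integral_eq_lintegral_ofReal hW.integrableOn (ae_restrict_of_ae hW0),
        ← ofReal_integral_eq_lintegral_ofReal integrable_condExp.integrableOn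
          (ae_restrict_of_ae hE0), setIntegral_condExp hm hW hs]
    have hh' : Measurable[m] fun ω => ENNReal.ofReal (h ω) := hh.ennreal_ofReal
    have h1 : ∀ w : Ω → ℝ, AEMeasurable w P → ∫⁻ ω, ENNReal.ofReal (w ω) * ENNReal.ofReal (h ω) ∂P
        = ∫⁻ ω, ENNReal.ofReal (h ω) ∂((P.withDensity fun ω => ENNReal.ofReal (w ω)).trim hm) := by
      intro w hw
      rw [lintegral_trim hm hh', lintegral_withDensity_eq_lintegral_mul₀ hw.ennreal_ofReal
        (hh'.mono hm le_rfl).aemeasurable]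
      rfl
    rw [h1 W hW.aemeasurable, h1 _ integrable_condExp.aemeasurable, hmeas]
  have hhm : AEStronglyMeasurable h P := (hh.mono hm le_rfl).aestronglyMeasurable
  have hof : ∀ w : Ω → ℝ, 0 ≤ᵐ[P] w → ∫⁻ ω, ENNReal.ofReal (h ω * w ω) ∂P
      = ∫⁻ ω, ENNReal.ofReal (w ω) * ENNReal.ofReal (h ω) ∂P := by
    intro w hw
    refine lintegral_congr_ae ?_
    filter_upwards [hw, hh0] with ω h1 h2
    rw [mul_comm, ENNReal.ofReal_mul h1]
  have n1 : 0 ≤ᵐ[P] fun ω => h ω * W ω := by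
    filter_upwards [hW0, hh0] with ω h1 h2 using mul_nonneg h2 h1
  have n2 : 0 ≤ᵐ[P] fun ω => h ω * (P[W | m]) ω := by
    filter_upwards [hE0, hh0] with ω h1 h2 using mul_nonneg h2 h1
  have hm1 := hhm.mul hW.aestronglyMeasurable
  refine ⟨⟨hm1, ?_⟩, ?_⟩
  · rw [hasFiniteIntegral_iff_ofReal n1, hof W hW0, key, ← hof _ hE0,
      ← hasFiniteIntegral_iff_ofReal n2]
    exact hi.2
  · rw [integral_eq_lintegral_of_nonneg_ae n1 hm1, integral_eq_lintegral_of_nonneg_ae n2 hi.1,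
      hof W hW0, hof _ hE0, key]

/-! ### One layer as a function of its Bernoulli parameter and its signs -/

/-- The sign `∏_{k ∈ s} (-1)^{ε_k}`. -/
def signProd (e : ℕ → Bool) (s : Finset ℕ) : ℝ := ∏ k ∈ s, if e k then -1 else 1

theorem abs_signProd (e : ℕ → Bool) (s : Finset ℕ) : |signProd e s| = 1 := by
  rw [signProd, Finset.abs_prod]
  refine Finset.prod_eq_one fun k _ => ?_
  split_ifs <;> simp

theorem signProd_mul_self (e : ℕ → Bool) (s : Finset ℕ) : signProd e s * signProd e s = 1 := by
  rw [← abs_mul_abs_self, abs_signProd, one_mul]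

theorem measurable_signProd (s : Finset ℕ) : Measurable fun e : ℕ → Bool => signProd e s := by
  unfold signProd
  refine Finset.measurable_prod _ fun k _ => ?_
  exact (measurable_of_countable fun b : Bool => if b then (-1 : ℝ) else 1).comp
    (measurable_pi_apply k)

/-- The common factors square to one, leaving only the signs between the two times. -/
theorem signProd_range_mul (e : ℕ → Bool) (j k : ℕ) :
    signProd e (Finset.range j) * signProd e (Finset.range k)
      = signProd e (Finset.Ico (min j k) (max j k)) := by
  wlog h : j ≤ k generalizing j k
  · rw [mul_comm, this k j (le_of_not_ge h), min_comm, max_comm]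
  rw [min_eq_left h, max_eq_right h]
  have h1 : signProd e (Finset.range k)
      = signProd e (Finset.range j) * signProd e (Finset.Ico j k) := by
    simp only [signProd]
    rw [Finset.prod_range_mul_prod_Ico _ h]
  rw [h1, ← mul_assoc, signProd_mul_self, one_mul]

/-- The centered sign `E[(-1)^{τ_j} | q] - (-1)^{τ_j}`, as a function of `d = (q, η)`. -/
def centeredSign (j : ℕ) (d : ℝ × (ℕ → Bool)) : ℝ :=
  (1 - 2 * d.1) ^ j - signProd d.2 (Finset.range j)

theorem measurable_centeredSign (j : ℕ) : Measurable (centeredSign j) := by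
  unfold centeredSign
  have := (measurable_signProd (Finset.range j)).comp
    (measurable_snd : Measurable fun d : ℝ × (ℕ → Bool) => d.2)
  exact (by fun_prop : Measurable fun d : ℝ × (ℕ → Bool) => (1 - 2 * d.1) ^ j).sub this

theorem abs_centeredSign_le {d : ℝ × (ℕ → Bool)} (hd : d.1 ∈ Set.Ioo (0 : ℝ) 1) (j : ℕ) :
    |centeredSign j d| ≤ 2 := by
  have h1 : |(1 - 2 * d.1) ^ j| ≤ 1 := by
    rw [abs_pow]
    refine pow_le_one₀ (abs_nonneg _) ?_
    rw [abs_le]; constructor <;> linarith [hd.1, hd.2]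
  have h2 := abs_signProd d.2 (Finset.range j)
  calc |centeredSign j d| ≤ |(1 - 2 * d.1) ^ j| + |signProd d.2 (Finset.range j)| := abs_sub _ _
    _ ≤ 2 := by linarith

theorem measurable_centeredSign_ceil (n : ℕ) : Measurable (Function.uncurry
    fun (t : ℝ) (d : ℝ × (ℕ → Bool)) => centeredSign ⌈(n : ℝ) * t⌉₊ d) := by
  have h1 : Measurable fun p : ℕ × (ℝ × (ℕ → Bool)) => centeredSign p.1 p.2 :=
    measurable_from_prod_countable_right measurable_centeredSign
  have h2 : Measurable fun p : ℝ × (ℝ × (ℕ → Bool)) => (⌈(n : ℝ) * p.1⌉₊, p.2) := by fun_prop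
  exact h1.comp h2

/-- The integral of the centered signs of a layer against `f`, at scale `n`. -/
def signIntegral (f : ℝ → ℝ) (n : ℕ) (d : ℝ × (ℕ → Bool)) : ℝ :=
  ∫ t, centeredSign ⌈(n : ℝ) * t⌉₊ d * f t ∂halfLine

theorem measurable_signIntegral {f : ℝ → ℝ} (hf : AEStronglyMeasurable f halfLine) (n : ℕ) :
    Measurable (signIntegral f n) :=
  measurable_integral_kernel (measurable_centeredSign_ceil n) hf

theorem abs_signIntegral_le {f : ℝ → ℝ} (hf : Integrable f halfLine) (n : ℕ)
    {d : ℝ × (ℕ → Bool)} (hd : d.1 ∈ Set.Ioo (0 : ℝ) 1) :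
    |signIntegral f n d| ≤ 2 * ∫ t, |f t| ∂halfLine :=
  abs_integral_kernel_le (V := fun t => centeredSign ⌈(n : ℝ) * t⌉₊ d)
    (fun _ => abs_centeredSign_le hd _) hf

/-- A Bernoulli parameter, uniform on `(0,1)`, with conditionally i.i.d. Bernoulli variables. -/
structure IsBernoulliLayer {Ω : Type*} [MeasurableSpace Ω] (q : Ω → ℝ) (η : ℕ → Ω → Bool)
    (P : Measure Ω) : Prop where
  measurable_q : Measurable q
  measurable_η : ∀ k, Measurable (η k)
  uniform_q : pdf.IsUniform q (Set.Ioo 0 1) P volume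
  bernoulli_η : IsCondIIDBernoulli q η P

theorem IsLayerModel.isBernoulliLayer {Ω : Type*} [MeasurableSpace Ω] {X q : ℕ → Ω → ℝ}
    {η : ℕ → ℕ → Ω → Bool} {P : Measure Ω} (h : IsLayerModel X q η P) (i : ℕ) :
    IsBernoulliLayer (q i) (η i) P :=
  ⟨h.measurable_q i, h.measurable_η i, h.uniform_q i, h.bernoulli_η i⟩

/-- The pair `(q, (η_j)_j)`. -/
def layerData {Ω : Type*} (q : Ω → ℝ) (η : ℕ → Ω → Bool) (ω : Ω) : ℝ × (ℕ → Bool) :=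
  (q ω, fun k => η k ω)

theorem stronglyMeasurable_comp_comap {Ω : Type*} {q : Ω → ℝ} {h : ℝ → ℝ} (hh : Measurable h) :
    StronglyMeasurable[MeasurableSpace.comap q inferInstance] fun ω => h (q ω) :=
  (hh.comp (comap_measurable q)).stronglyMeasurable

namespace IsBernoulliLayer

variable {Ω : Type*} [MeasurableSpace Ω] {P : Measure Ω} {q : Ω → ℝ} {η : ℕ → Ω → Bool}

theorem measurable_layerData (h : IsBernoulliLayer q η P) : Measurable (layerData q η) :=
  h.measurable_q.prodMk (measurable_pi_lambda _ h.measurable_η)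

theorem comap_le (h : IsBernoulliLayer q η P) :
    MeasurableSpace.comap q inferInstance ≤ (inferInstance : MeasurableSpace Ω) :=
  h.measurable_q.comap_le

theorem map_q (h : IsBernoulliLayer q η P) : P.map q = unitMeasure := by
  have h1 := h.uniform_q
  rw [pdf.IsUniform, ProbabilityTheory.cond] at h1
  rw [h1]
  simp

theorem ae_mem_Ioo (h : IsBernoulliLayer q η P) : ∀ᵐ ω ∂P, q ω ∈ Set.Ioo (0 : ℝ) 1 := by
  have h1 : ∀ᵐ u ∂(P.map q), u ∈ Set.Ioo (0 : ℝ) 1 := by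
    rw [h.map_q]
    exact ae_restrict_mem measurableSet_Ioo
  exact ae_of_ae_map h.measurable_q.aemeasurable h1

theorem measurable_signProd_comp (h : IsBernoulliLayer q η P) (s : Finset ℕ) :
    Measurable fun ω => signProd (fun k => η k ω) s :=
  (measurable_signProd s).comp (measurable_pi_lambda _ h.measurable_η)

theorem measurable_signIntegral_comp {f : ℝ → ℝ} (h : IsBernoulliLayer q η P)
    (hf : AEStronglyMeasurable f halfLine) (n : ℕ) :
    Measurable fun ω => signIntegral f n (layerData q η ω) :=
  (measurable_signIntegral hf n).comp h.measurable_layerData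

variable [IsProbabilityMeasure P]

theorem integrable_signProd (h : IsBernoulliLayer q η P) (s : Finset ℕ) :
    Integrable (fun ω => signProd (fun k => η k ω) s) P :=
  Integrable.of_bound (h.measurable_signProd_comp s).aestronglyMeasurable 1
    (ae_of_all _ fun _ => (abs_signProd _ s).le)

theorem condExp_signProd (h : IsBernoulliLayer q η P) (s : Finset ℕ) :
    P[fun ω => signProd (fun k => η k ω) s | MeasurableSpace.comap q inferInstance]
      =ᵐ[P] fun ω => (1 - 2 * q ω) ^ s.card := by
  classical
  set A : Finset ℕ → Set Ω := fun t => {ω | ∀ k ∈ s, η k ω = decide (k ∈ t)} with hA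
  have hAm : ∀ t, MeasurableSet (A t) := by
    intro t
    have : A t = ⋂ k ∈ s, (η k) ⁻¹' {decide (k ∈ t)} := by
      ext ω
      simp [hA]
    rw [this]
    exact Finset.measurableSet_biInter _ fun k _ => h.measurable_η k (measurableSet_singleton _)
  have hdecomp : (fun ω => signProd (fun k => η k ω) s)
      = ∑ t ∈ s.powerset, ((-1 : ℝ) ^ t.card) • (A t).indicator fun _ => (1 : ℝ) := by
    funext ω
    rw [Finset.sum_apply, Finset.sum_eq_single (s.filter fun k => η k ω = true)]
    · have hmem : ω ∈ A (s.filter fun k => η k ω = true) := by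
        intro k hk
        simp [hk]
      rw [Pi.smul_apply, Set.indicator_of_mem hmem, smul_eq_mul, mul_one, signProd,
        Finset.prod_ite]
      simp
    · intro t ht hne
      have hnot : ω ∉ A t := by
        intro hmem
        refine hne ?_
        ext k
        rw [Finset.mem_filter]
        constructor
        · intro hk
          have hks := Finset.mem_powerset.1 ht hk
          exact ⟨hks, by rw [hmem k hks]; simpa using hk⟩
        · rintro ⟨hks, hk⟩
          rw [hmem k hks] at hk
          simpa using hk
      rw [Pi.smul_apply, Set.indicator_of_notMem hnot, smul_zero]
    · intro hne
      exact absurd (Finset.mem_powerset.2 (Finset.filter_subset _ _)) hne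
  have hint : ∀ t, Integrable ((A t).indicator fun _ => (1 : ℝ)) P := fun t =>
    (integrable_const 1).indicator (hAm t)
  have hB : ∀ᵐ ω ∂P, ∀ t ∈ s.powerset,
      (P[((-1 : ℝ) ^ t.card) • (A t).indicator fun _ => (1 : ℝ) |
        MeasurableSpace.comap q inferInstance]) ω
      = (-q ω) ^ t.card * (1 - q ω) ^ (s.card - t.card) := by
    rw [Finset.eventually_all]
    intro t ht
    have hts := Finset.mem_powerset.1 ht
    filter_upwards [condExp_smul ((-1 : ℝ) ^ t.card) ((A t).indicator fun _ => (1 : ℝ))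
      (MeasurableSpace.comap q inferInstance), h.bernoulli_η s fun k => decide (k ∈ t)]
      with ω h1 h2
    rw [h1, Pi.smul_apply, h2, smul_eq_mul]
    simp only [decide_eq_true_eq]
    rw [Finset.prod_ite]
    have e1 : (s.filter fun k => k ∈ t) = t := by
      ext k; simp only [Finset.mem_filter]; exact ⟨fun hk => hk.2, fun hk => ⟨hts hk, hk⟩⟩
    have e2 : (s.filter fun k => k ∉ t) = s \ t := by
      ext k; simp
    rw [e1, e2, Finset.prod_const, Finset.prod_const, Finset.card_sdiff_of_subset hts, neg_pow]
    ring
  rw [hdecomp]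
  filter_upwards [condExp_finsetSum (s := s.powerset) (fun t _ => (hint t).smul ((-1 : ℝ) ^ t.card))
    (MeasurableSpace.comap q inferInstance), hB] with ω h1 h2
  rw [h1, Finset.sum_apply, Finset.sum_congr rfl h2, Finset.sum_pow_mul_eq_add_pow]
  congr 1
  ring

theorem integrable_pow_q (h : IsBernoulliLayer q η P) (j : ℕ) :
    Integrable (fun ω => (1 - 2 * q ω) ^ j) P := by
  have hq := h.measurable_q
  refine Integrable.of_bound (Measurable.aestronglyMeasurable (by fun_prop)) 1 ?_
  filter_upwards [h.ae_mem_Ioo] with ω hω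
  rw [norm_pow]
  refine pow_le_one₀ (norm_nonneg _) ?_
  rw [Real.norm_eq_abs, abs_le]; constructor <;> linarith [hω.1, hω.2]

theorem integrable_pow_q_mul (h : IsBernoulliLayer q η P) (j : ℕ) (s : Finset ℕ) :
    Integrable (fun ω => (1 - 2 * q ω) ^ j * signProd (fun k => η k ω) s) P := by
  have hq := h.measurable_q
  refine (h.integrable_signProd s).bdd_mul (c := 1)
    (Measurable.aestronglyMeasurable (by fun_prop)) ?_
  filter_upwards [h.ae_mem_Ioo] with ω hω
  rw [norm_pow]
  refine pow_le_one₀ (norm_nonneg _) ?_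
  rw [Real.norm_eq_abs, abs_le]; constructor <;> linarith [hω.1, hω.2]

theorem condExp_pow_q_mul (h : IsBernoulliLayer q η P) (j : ℕ) (s : Finset ℕ) :
    P[fun ω => (1 - 2 * q ω) ^ j * signProd (fun k => η k ω) s |
      MeasurableSpace.comap q inferInstance] =ᵐ[P] fun ω => (1 - 2 * q ω) ^ (j + s.card) := by
  have h1 := condExp_mul_of_stronglyMeasurable_left (m := MeasurableSpace.comap q inferInstance)
    (stronglyMeasurable_comp_comap (q := q) (h := fun u => (1 - 2 * u) ^ j) (by fun_prop))
    (h.integrable_pow_q_mul j s) (h.integrable_signProd s)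
  filter_upwards [h1, h.condExp_signProd s] with ω e1 e2
  rw [pow_add, ← e2]
  exact e1

/-- Each cross term has conditional mean `(1-2q)^{j+k}`, as does the product of the means; the
product of the signs involves `|j-k|` Bernoulli variables. -/
theorem condExp_centeredSign_mul (h : IsBernoulliLayer q η P) (j k : ℕ) :
    P[fun ω => centeredSign j (layerData q η ω) * centeredSign k (layerData q η ω) |
      MeasurableSpace.comap q inferInstance] =ᵐ[P] fun ω => signKernel (q ω) j k := by
  set F0 : Ω → ℝ := fun ω => (1 - 2 * q ω) ^ (j + k) with hF0
  set F1 : Ω → ℝ := fun ω => (1 - 2 * q ω) ^ j * signProd (fun l => η l ω) (Finset.range k) with hF1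
  set F2 : Ω → ℝ := fun ω => (1 - 2 * q ω) ^ k * signProd (fun l => η l ω) (Finset.range j) with hF2
  set F3 : Ω → ℝ := fun ω => signProd (fun l => η l ω) (Finset.Ico (min j k) (max j k)) with hF3
  have heq : (fun ω => centeredSign j (layerData q η ω) * centeredSign k (layerData q η ω))
      = F0 - F1 - F2 + F3 := by
    funext ω
    simp only [Pi.add_apply, Pi.sub_apply, hF0, hF1, hF2, hF3]
    rw [← signProd_range_mul]
    simp only [centeredSign, layerData]
    ring
  have i0 : Integrable F0 P := h.integrable_pow_q _
  have i1 : Integrable F1 P := h.integrable_pow_q_mul _ _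
  have i2 : Integrable F2 P := h.integrable_pow_q_mul _ _
  have i3 : Integrable F3 P := h.integrable_signProd _
  have c0 : P[F0 | MeasurableSpace.comap q inferInstance] = F0 :=
    condExp_of_stronglyMeasurable h.comap_le
      (stronglyMeasurable_comp_comap (h := fun u => (1 - 2 * u) ^ (j + k)) (by fun_prop)) i0
  rw [heq]
  filter_upwards [condExp_add ((i0.sub i1).sub i2) i3 (MeasurableSpace.comap q inferInstance),
    condExp_sub (i0.sub i1) i2 (MeasurableSpace.comap q inferInstance),
    condExp_sub i0 i1 (MeasurableSpace.comap q inferInstance),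
    h.condExp_pow_q_mul j (Finset.range k), h.condExp_pow_q_mul k (Finset.range j),
    h.condExp_signProd (Finset.Ico (min j k) (max j k))] with ω e1 e2 e3 e4 e5 e6
  rw [e1, Pi.add_apply, e2, Pi.sub_apply, e3, Pi.sub_apply, c0, e4, e5, e6]
  simp only [hF0, Finset.card_range, Nat.card_Ico, signKernel]
  rw [add_comm k j]
  ring

theorem integrable_centeredSign_mul (h : IsBernoulliLayer q η P) (j k : ℕ) :
    Integrable (fun ω => centeredSign j (layerData q η ω) * centeredSign k (layerData q η ω)) P := by
  have hm : ∀ j, Measurable fun ω => centeredSign j (layerData q η ω) := fun j =>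
    (measurable_centeredSign j).comp h.measurable_layerData
  refine Integrable.of_bound ((hm j).mul (hm k)).aestronglyMeasurable (2 * 2) ?_
  filter_upwards [h.ae_mem_Ioo] with ω hω
  rw [norm_mul]
  have h1 := abs_centeredSign_le (d := layerData q η ω) hω
  exact mul_le_mul (h1 j) (h1 k) (norm_nonneg _) (by norm_num)

section SignIntegral

variable {f : ℝ → ℝ}

theorem integrable_signIntegral_sq (h : IsBernoulliLayer q η P) (hf : Integrable f halfLine)
    (n : ℕ) : Integrable (fun ω => signIntegral f n (layerData q η ω) ^ 2) P := by
  refine Integrable.of_bound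
    ((h.measurable_signIntegral_comp hf.aestronglyMeasurable n).pow_const 2).aestronglyMeasurable
    ((2 * ∫ t, |f t| ∂halfLine) ^ 2) ?_
  filter_upwards [h.ae_mem_Ioo] with ω hω
  rw [norm_pow]
  exact pow_le_pow_left₀ (norm_nonneg _) (abs_signIntegral_le hf n hω) 2

theorem integrable_layerVariance_comp (h : IsBernoulliLayer q η P) (hf : Integrable f halfLine)
    (n : ℕ) : Integrable (fun ω => layerVariance f n (q ω)) P := by
  refine Integrable.of_bound ((stronglyMeasurable_layerVariance hf.aestronglyMeasurable
    n).measurable.comp h.measurable_q).aestronglyMeasurable ((∫ t, |f t| ∂halfLine) ^ 2) ?_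
  filter_upwards [h.ae_mem_Ioo] with ω hω
  exact abs_layerVariance_le hf n hω

/-- Testing on sets `B` of `σ(q)` lets Fubini's theorem move the average inside the `t`-integrals,
so that conditional covariances are needed only for each fixed pair `(j,k)`, never for a continuum
of times at once. -/
theorem setIntegral_signIntegral_sq (h : IsBernoulliLayer q η P) (hf : Integrable f halfLine)
    (n : ℕ) {B : Set Ω} (hB : MeasurableSet[MeasurableSpace.comap q inferInstance] B) :
    ∫ ω in B, signIntegral f n (layerData q η ω) ^ 2 ∂P = ∫ ω in B, layerVariance f n (q ω) ∂P := by
  have hV : Measurable (Function.uncurry fun (t : ℝ) (ω : Ω) =>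
      centeredSign ⌈(n : ℝ) * t⌉₊ (layerData q η ω)) := by
    have h0 : Measurable fun p : ℝ × Ω => (p.1, layerData q η p.2) :=
      measurable_fst.prodMk (h.measurable_layerData.comp measurable_snd)
    have h1 := (measurable_centeredSign_ceil n).comp h0
    simpa only [Function.comp_def, Function.uncurry_def] using h1
  have hC : ∀ᵐ ω ∂(P.restrict B), ∀ t : ℝ,
      |centeredSign ⌈(n : ℝ) * t⌉₊ (layerData q η ω)| ≤ 2 := by
    filter_upwards [ae_restrict_of_ae h.ae_mem_Ioo] with ω hω t
    exact abs_centeredSign_le (d := layerData q η ω) hω _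
  have h1 := integral_mul_integral_kernel (P.restrict B) hV hC hf hf
  have h2 : ∀ j k, ∫ ω in B, centeredSign j (layerData q η ω) * centeredSign k (layerData q η ω) ∂P
      = ∫ ω in B, signKernel (q ω) j k ∂P := by
    intro j k
    rw [← setIntegral_condExp h.comap_le (h.integrable_centeredSign_mul j k) hB]
    exact integral_congr_ae (ae_restrict_of_ae (h.condExp_centeredSign_mul j k))
  simp_rw [h2] at h1
  have h3 : ∫ ω in B, signIntegral f n (layerData q η ω) ^ 2 ∂P = ∫ ω in B,
      (∫ t, centeredSign ⌈(n : ℝ) * t⌉₊ (layerData q η ω) * f t ∂halfLine) *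
      (∫ t, centeredSign ⌈(n : ℝ) * t⌉₊ (layerData q η ω) * f t ∂halfLine) ∂P := by
    simp_rw [sq]
    rfl
  rw [h3, h1]
  simp only [layerVariance]
  have hff : Integrable (fun z : ℝ × ℝ => f z.1 * f z.2) quadrantMeasure := hf.mul_prod hf
  rw [integral_integral_swap]
  · simp_rw [integral_const_mul]
  · refine Integrable.mono' ((integrable_const (1 : ℝ)).mul_prod hff.norm) ?_ ?_
    · exact hff.aestronglyMeasurable.comp_snd.mul ((measurable_signKernel_ceil n).comp
        ((h.measurable_q.comp measurable_fst).prodMk measurable_snd)).aestronglyMeasurable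
    · filter_upwards [Measure.quasiMeasurePreserving_fst.ae (ae_restrict_of_ae h.ae_mem_Ioo)]
        with p hp
      simp only [Function.uncurry]
      rw [norm_mul, mul_comm]
      gcongr
      exact (abs_signKernel_le hp _ _).trans (min_le_left _ _)

theorem condExp_signIntegral_sq (h : IsBernoulliLayer q η P) (hf : Integrable f halfLine)
    (n : ℕ) : P[fun ω => signIntegral f n (layerData q η ω) ^ 2 |
      MeasurableSpace.comap q inferInstance] =ᵐ[P] fun ω => layerVariance f n (q ω) := by
  symm
  refine ae_eq_condExp_of_forall_setIntegral_eq h.comap_le (h.integrable_signIntegral_sq hf n)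
    (fun s _ _ => (h.integrable_layerVariance_comp hf n).integrableOn)
    (fun s hs _ => (h.setIntegral_signIntegral_sq hf n hs).symm) ?_
  exact (stronglyMeasurable_comp_comap
    (stronglyMeasurable_layerVariance hf.aestronglyMeasurable n).measurable).aestronglyMeasurable

/-- Transfers moments of a layer, weighted by the unbounded functions `q⁻¹` and `q^{-1-κ}`, to
integrals over the unit interval. -/
theorem integral_weight_signIntegral_sq (h : IsBernoulliLayer q η P) (hf : Integrable f halfLine)
    (n : ℕ) {w : ℝ → ℝ} (hw : Measurable w) (hw0 : ∀ u ∈ Set.Ioo (0 : ℝ) 1, 0 ≤ w u)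
    (hi : Integrable (fun u => w u * layerVariance f n u) unitMeasure) :
    Integrable (fun ω => w (q ω) * signIntegral f n (layerData q η ω) ^ 2) P ∧
    ∫ ω, w (q ω) * signIntegral f n (layerData q η ω) ^ 2 ∂P
      = ∫ u, w u * layerVariance f n u ∂unitMeasure := by
  have hm : AEStronglyMeasurable (fun u => w u * layerVariance f n u) (P.map q) :=
    (hw.mul (stronglyMeasurable_layerVariance
      hf.aestronglyMeasurable n).measurable).aestronglyMeasurable
  have hc := h.condExp_signIntegral_sq hf n
  have hi2 : Integrable (fun ω => w (q ω) * layerVariance f n (q ω)) P := by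
    rw [← h.map_q] at hi
    exact (integrable_map_measure hm h.measurable_q.aemeasurable).1 hi
  have heq : (fun ω => w (q ω) * (P[fun ω => signIntegral f n (layerData q η ω) ^ 2 |
      MeasurableSpace.comap q inferInstance]) ω)
      =ᵐ[P] fun ω => w (q ω) * layerVariance f n (q ω) := by
    filter_upwards [hc] with ω e
    rw [e]
  have h1 := integral_mul_condExp h.comap_le (h.integrable_signIntegral_sq hf n)
    (ae_of_all _ fun _ => sq_nonneg _)
    (stronglyMeasurable_comp_comap hw).measurable
    (h.ae_mem_Ioo.mono fun _ hω => hw0 _ hω) (hi2.congr heq.symm)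
  refine ⟨h1.1, h1.2.trans ?_⟩
  rw [integral_congr_ae heq, ← h.map_q, integral_map h.measurable_q.aemeasurable hm]

end SignIntegral

end IsBernoulliLayer

/-! ### The Laplace transform of a layer -/

/-- From `e^{-x} ≤ 1/(1+x)` the error is at most `x · x/(1+x)`, and `x/(1+x) ≤ min x 1 ≤ x^κ`. An
exponent below the quadratic one matters: a bound by `x²` would bring in the weight `u⁻²`, against
which the linear bound on the kernel near zero is not integrable. -/
theorem abs_sub_one_sub_exp_neg_le {x κ : ℝ} (hx : 0 ≤ x) (hκ0 : 0 ≤ κ) (hκ1 : κ ≤ 1) :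
    |x - (1 - Real.exp (-x))| ≤ x * x ^ κ := by
  have h1 := Real.add_one_le_exp (-x)
  have h2 : Real.exp (-x) ≤ 1 / (1 + x) := by
    rw [Real.exp_neg, ← one_div]
    exact one_div_le_one_div_of_le (by linarith) (by linarith [Real.add_one_le_exp x])
  have h3 : x / (1 + x) ≤ x ^ κ := by
    rcases le_total x 1 with h | h
    · calc x / (1 + x) ≤ x := div_le_self hx (by linarith)
        _ = x ^ (1 : ℝ) := (Real.rpow_one x).symm
        _ ≤ x ^ κ := by
          rcases hx.eq_or_lt with rfl | hx0
          · rw [Real.zero_rpow one_ne_zero]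
            exact Real.rpow_nonneg le_rfl _
          · exact Real.rpow_le_rpow_of_exponent_ge hx0 h hκ1
    · exact ((div_le_one (by linarith)).2 (by linarith)).trans (Real.one_le_rpow h hκ0)
  rw [abs_of_nonneg (by linarith)]
  calc x - (1 - Real.exp (-x)) ≤ x - (1 - 1 / (1 + x)) := by linarith
    _ = x * (x / (1 + x)) := by
      have : 1 + x ≠ 0 := by linarith
      field_simp
      ring
    _ ≤ x * x ^ κ := by gcongr

/-- The factor `Y` such that the contribution of a layer to `G_n(f)` is `𝒳 Y / √m_n`. -/
def layerWeight (f : ℝ → ℝ) (n : ℕ) (d : ℝ × (ℕ → Bool)) : ℝ :=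
  (Real.sqrt d.1)⁻¹ * signIntegral f n d

theorem measurable_layerWeight {f : ℝ → ℝ} (hf : AEStronglyMeasurable f halfLine) (n : ℕ) :
    Measurable (layerWeight f n) :=
  (by fun_prop : Measurable fun d : ℝ × (ℕ → Bool) => (Real.sqrt d.1)⁻¹).mul
    (measurable_signIntegral hf n)

theorem layerWeight_sq (f : ℝ → ℝ) (n : ℕ) {d : ℝ × (ℕ → Bool)} (hd : 0 ≤ d.1) :
    layerWeight f n d ^ 2 = d.1⁻¹ * signIntegral f n d ^ 2 := by
  rw [layerWeight, mul_pow, inv_pow, Real.sq_sqrt hd]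

/-- The constant in the bound for the Laplace transform of a layer. -/
def layerConstant (κ : ℝ) (f : ℝ → ℝ) : ℝ :=
  1 / 2 * (2 * (∫ t, |f t| ∂halfLine) ^ 2) ^ κ * ((4 / (1 - κ) + 1 / κ) *
    ((∫ s, (1 + s) ^ κ * |f s| ∂halfLine) * ∫ t, |f t| ∂halfLine))

section Layer

variable {Ω : Type*} [MeasurableSpace Ω] {P : Measure Ω} [IsProbabilityMeasure P]
  {q : Ω → ℝ} {η : ℕ → Ω → Bool} {δ κ : ℝ} {f : ℝ → ℝ}

/-- With `x = Y²/(2m)`, the mean of `x` is the variance term and the error is at most `E[x · x^κ]`.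
The factor `x^κ` is bounded pointwise by a multiple of `(m q)^{-κ}`, and what remains is a moment
with weight `q^{-1-κ}`, of order `n^κ`. -/
theorem IsBernoulliLayer.abs_laplace_sub_le (h : IsBernoulliLayer q η P) (hκ : 0 < κ) (hκ1 : κ < 1)
    (hκδ : κ ≤ δ) (hf : f ∈ TestClass δ) {n m : ℕ} (hn : 0 < n) (hm : 0 < m) :
    |aggregatedVariance f n / (2 * m)
      - (1 - ∫ ω, Real.exp (-(layerWeight f n (layerData q η ω) ^ 2 / (2 * m))) ∂P)|
      ≤ (m : ℝ)⁻¹ * (layerConstant κ f * ((n : ℝ) / m) ^ κ) := by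
  have hfi := TestClass.integrable (hκ.le.trans hκδ) hf
  have hm0 : (0 : ℝ) < m := by exact_mod_cast hm
  set A := ∫ t, |f t| ∂halfLine with hA
  have hA0 : 0 ≤ A := integral_nonneg fun _ => abs_nonneg _
  set x : Ω → ℝ := fun ω => layerWeight f n (layerData q η ω) ^ 2 / (2 * m) with hx
  have hx0 : ∀ ω, 0 ≤ x ω := fun ω => by positivity
  have hxm : Measurable x :=
    (((measurable_layerWeight hfi.aestronglyMeasurable n).comp
      h.measurable_layerData).pow_const 2).div_const _
  obtain ⟨v1, v2⟩ := integral_inv_layerVariance hκ hκ1 hκδ hf hn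
  obtain ⟨r1, -, r2⟩ := integral_rpow_layerVariance hκ hκ1 hκδ hf hn (h := fun u => u ^ (-1 - κ))
    (by fun_prop) (fun u hu => Real.rpow_nonneg hu.1.le _) (fun _ _ => le_rfl)
  obtain ⟨s1, s2⟩ := h.integral_weight_signIntegral_sq hfi n (w := fun u => u⁻¹) (by fun_prop)
    (fun u hu => inv_nonneg.2 hu.1.le) v1
  obtain ⟨t1, t2⟩ := h.integral_weight_signIntegral_sq hfi n (w := fun u => u ^ (-1 - κ))
    (by fun_prop) (fun u hu => Real.rpow_nonneg hu.1.le _) r1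
  have hxe : x =ᵐ[P] fun ω => ((q ω)⁻¹ * signIntegral f n (layerData q η ω) ^ 2) / (2 * m) := by
    filter_upwards [h.ae_mem_Ioo] with ω hω
    simp only [hx]
    rw [layerWeight_sq f n (d := layerData q η ω) hω.1.le]
    rfl
  have hxi : Integrable x P := (s1.div_const (2 * (m : ℝ))).congr hxe.symm
  have hxv : ∫ ω, x ω ∂P = aggregatedVariance f n / (2 * m) := by
    rw [integral_congr_ae hxe, integral_div, s2, v2]
  have hei : Integrable (fun ω => Real.exp (-x ω)) P := by
    refine Integrable.of_bound (by fun_prop) 1 (ae_of_all _ fun ω => ?_)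
    rw [Real.norm_of_nonneg (Real.exp_pos _).le]
    exact Real.exp_le_one_iff.2 (neg_nonpos.2 (hx0 ω))
  have hdiff : aggregatedVariance f n / (2 * m) - (1 - ∫ ω, Real.exp (-x ω) ∂P)
      = ∫ ω, (x ω - (1 - Real.exp (-x ω))) ∂P := by
    have hei1 : Integrable (fun ω => 1 - Real.exp (-x ω)) P := (integrable_const 1).sub hei
    rw [integral_sub hxi hei1, integral_sub (integrable_const 1) hei, hxv]
    simp
  rw [hdiff, ← Real.norm_eq_abs]
  -- Collects the factor `1/(2m)` of `x` and the constants of `x^κ`, where `x ≤ (2A)²/(2mq) =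
  -- 2A²/(mq)`.
  set c := (m : ℝ)⁻¹ * (1 / 2 * (2 * A ^ 2) ^ κ * ((m : ℝ)⁻¹) ^ κ) with hc
  have hc0 : 0 ≤ c := by positivity
  refine (norm_integral_le_of_norm_le (t1.const_mul c) ?_).trans ?_
  · filter_upwards [hxe, h.ae_mem_Ioo] with ω hω hq
    rw [Real.norm_eq_abs]
    refine (abs_sub_one_sub_exp_neg_le (hx0 ω) hκ.le hκ1.le).trans ?_
    have hZ : signIntegral f n (layerData q η ω) ^ 2 ≤ (2 * A) ^ 2 :=
      sq_le_sq.2 ((abs_signIntegral_le hfi n (d := layerData q η ω) hq).trans (le_abs_self _))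
    have hq0 := hq.1
    have hxle : x ω ≤ (2 * A ^ 2) * (m : ℝ)⁻¹ * (q ω)⁻¹ := by
      rw [hω]
      calc (q ω)⁻¹ * signIntegral f n (layerData q η ω) ^ 2 / (2 * m)
          ≤ (q ω)⁻¹ * (2 * A) ^ 2 / (2 * m) := by gcongr
        _ = _ := by field_simp
    have hpow : x ω ^ κ ≤ (2 * A ^ 2) ^ κ * ((m : ℝ)⁻¹) ^ κ * ((q ω)⁻¹) ^ κ := by
      rw [← Real.mul_rpow (by positivity) (by positivity),
        ← Real.mul_rpow (by positivity) (by positivity)]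
      exact Real.rpow_le_rpow (hx0 ω) hxle hκ.le
    have hqpow : (q ω) ^ (-1 - κ) = (q ω)⁻¹ * ((q ω)⁻¹) ^ κ := by
      rw [Real.inv_rpow hq0.le, ← Real.rpow_neg hq0.le, ← Real.rpow_neg_one, ← Real.rpow_add hq0]
      congr 1
    calc x ω * x ω ^ κ
        ≤ x ω * ((2 * A ^ 2) ^ κ * ((m : ℝ)⁻¹) ^ κ * ((q ω)⁻¹) ^ κ) := by
          gcongr
      _ = c * ((q ω) ^ (-1 - κ) * signIntegral f n (layerData q η ω) ^ 2) := by
          rw [hω, hqpow, hc]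
          field_simp
  · rw [integral_const_mul, t2]
    calc c * ∫ u, u ^ (-1 - κ) * layerVariance f n u ∂unitMeasure
        ≤ c * ((4 / (1 - κ) + 1 / κ) * (n : ℝ) ^ κ *
          ((∫ s, (1 + s) ^ κ * |f s| ∂halfLine) * A)) :=
          mul_le_mul_of_nonneg_left ((le_abs_self _).trans r2) hc0
      _ = _ := by
          have hnm : ((n : ℝ) / m) ^ κ = (n : ℝ) ^ κ * ((m : ℝ)⁻¹) ^ κ := by
            rw [div_eq_mul_inv, Real.mul_rpow (by positivity) (by positivity)]
          rw [hc, layerConstant, hnm, ← hA]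
          ring

/-- Factors are exchanged one at a time, all the others having modulus at most one. -/
theorem abs_prod_sub_prod_le {ι : Type*} (s : Finset ι) {a b : ι → ℝ} (ha : ∀ i ∈ s, |a i| ≤ 1)
    (hb : ∀ i ∈ s, |b i| ≤ 1) : |∏ i ∈ s, a i - ∏ i ∈ s, b i| ≤ ∑ i ∈ s, |a i - b i| := by
  classical
  induction s using Finset.induction_on with
  | empty => simp
  | insert i s hi ih =>
    rw [Finset.prod_insert hi, Finset.prod_insert hi, Finset.sum_insert hi]
    have h1 := ih (fun j hj => ha j (Finset.mem_insert_of_mem hj))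
      (fun j hj => hb j (Finset.mem_insert_of_mem hj))
    have h2 : |∏ j ∈ s, a j| ≤ 1 := by
      rw [Finset.abs_prod]
      exact Finset.prod_le_one (fun _ _ => abs_nonneg _)
        (fun j hj => ha j (Finset.mem_insert_of_mem hj))
    calc |a i * ∏ j ∈ s, a j - b i * ∏ j ∈ s, b j|
        = |(a i - b i) * ∏ j ∈ s, a j + b i * (∏ j ∈ s, a j - ∏ j ∈ s, b j)| := by ring_nf
      _ ≤ |a i - b i| * |∏ j ∈ s, a j| + |b i| * |∏ j ∈ s, a j - ∏ j ∈ s, b j| := by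
        rw [← abs_mul, ← abs_mul]
        exact abs_add_le _ _
      _ ≤ |a i - b i| * 1 + 1 * ∑ j ∈ s, |a j - b j| := by
        gcongr
        exact hb i (Finset.mem_insert_self _ _)
      _ = _ := by ring

theorem aggregatedVariance_nonneg (h : IsBernoulliLayer q η P) (hκ : 0 < κ) (hκ1 : κ < 1)
    (hκδ : κ ≤ δ) (hf : f ∈ TestClass δ) {n : ℕ} (hn : 0 < n) : 0 ≤ aggregatedVariance f n := by
  have hfi := TestClass.integrable (hκ.le.trans hκδ) hf
  obtain ⟨v1, v2⟩ := integral_inv_layerVariance hκ hκ1 hκδ hf hn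
  obtain ⟨s1, s2⟩ := h.integral_weight_signIntegral_sq hfi n (w := fun u => u⁻¹) (by fun_prop)
    (fun u hu => inv_nonneg.2 hu.1.le) v1
  rw [← v2, ← s2]
  refine integral_nonneg_of_ae ?_
  filter_upwards [h.ae_mem_Ioo] with ω hω
  exact mul_nonneg (inv_nonneg.2 hω.1.le) (sq_nonneg _)

end Layer

/-! ### From one layer to the product over independent layers -/

section Layers

variable {Ω : Type*} [MeasurableSpace Ω] {P : Measure Ω} [IsProbabilityMeasure P]
  {q : ℕ → Ω → ℝ} {η : ℕ → ℕ → Ω → Bool} {δ κ : ℝ} {f : ℝ → ℝ}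

/-- The target `exp(-v/2)` is written as the `m`-th power of `exp(-v/(2m))`. Each Laplace transform
and each such factor is compared with `1 - v/(2m)`, the latter with exponent `κ = 1`; summing `m`
errors cancels the prefactor `m⁻¹`. -/
theorem abs_prod_laplace_sub_le (h : ∀ i, IsBernoulliLayer (q i) (η i) P) (hκ : 0 < κ)
    (hκ1 : κ < 1) (hκδ : κ ≤ δ) (hf : f ∈ TestClass δ) {n m : ℕ} (hn : 0 < n) (hm : 0 < m) :
    |∏ i ∈ Finset.range m,
        ∫ ω, Real.exp (-(layerWeight f n (layerData (q i) (η i) ω) ^ 2 / (2 * m))) ∂P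
      - Real.exp (-(aggregatedVariance f n / 2))|
      ≤ layerConstant κ f * ((n : ℝ) / m) ^ κ + (aggregatedVariance f n / 2) ^ 2 / m := by
  have hm0 : (0 : ℝ) < m := by exact_mod_cast hm
  set v := aggregatedVariance f n with hv
  have hv0 : 0 ≤ v := aggregatedVariance_nonneg (h 0) hκ hκ1 hκδ hf hn
  set b := Real.exp (-(v / (2 * m))) with hb
  have hbm : Real.exp (-(v / 2)) = ∏ _i ∈ Finset.range m, b := by
    rw [Finset.prod_const, Finset.card_range, hb, ← Real.exp_nat_mul]
    congr 1
    field_simp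
  rw [hbm]
  refine (abs_prod_sub_prod_le _ (fun i _ => ?_) (fun i _ => ?_)).trans ?_
  · rw [← Real.norm_eq_abs]
    refine (norm_integral_le_of_norm_le_const (C := 1) (ae_of_all _ fun ω => ?_)).trans (by simp)
    rw [Real.norm_of_nonneg (Real.exp_pos _).le]
    exact Real.exp_le_one_iff.2 (neg_nonpos.2 (by positivity))
  · rw [abs_of_pos (Real.exp_pos _)]
    exact Real.exp_le_one_iff.2 (neg_nonpos.2 (by positivity))
  · have hterm : ∀ i ∈ Finset.range m,
        |(∫ ω, Real.exp (-(layerWeight f n (layerData (q i) (η i) ω) ^ 2 / (2 * m))) ∂P) - b|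
        ≤ (m : ℝ)⁻¹ * (layerConstant κ f * ((n : ℝ) / m) ^ κ + (v / 2) ^ 2 / m) := by
      intro i _
      have h1 := (h i).abs_laplace_sub_le hκ hκ1 hκδ hf hn hm
      have h2 := abs_sub_one_sub_exp_neg_le (x := v / (2 * m)) (κ := 1) (by positivity)
        zero_le_one le_rfl
      rw [Real.rpow_one] at h2
      have h3 : v / (2 * m) * (v / (2 * m)) = (m : ℝ)⁻¹ * ((v / 2) ^ 2 / m) := by
        field_simp
      rw [h3] at h2
      rw [← hv] at h1
      rw [mul_add]
      refine le_trans ?_ (add_le_add h1 h2)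
      refine le_trans (le_of_eq ?_) (abs_sub _ _)
      congr 1
      rw [hb]
      ring
    refine (Finset.sum_le_card_nsmul _ _ _ hterm).trans_eq ?_
    rw [Finset.card_range, nsmul_eq_mul, mul_inv_cancel_left₀ hm0.ne']

theorem tendsto_prod_laplace (h : ∀ i, IsBernoulliLayer (q i) (η i) P) (hδ : 0 < δ)
    (hf : f ∈ TestClass δ) {m : ℕ → ℕ} (hm : Tendsto (fun n : ℕ => (m n : ℝ) / n) atTop atTop) :
    Tendsto (fun n : ℕ => ∏ i ∈ Finset.range (m n),
        ∫ ω, Real.exp (-(layerWeight f n (layerData (q i) (η i) ω) ^ 2 / (2 * m n))) ∂P) atTop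
      (𝓝 (Real.exp (-((∫ z, logIntegrand f f z ∂quadrantMeasure) / 2)))) := by
  -- Any exponent in `(0,1)` not exceeding `δ` would do.
  set κ : ℝ := min δ (1 / 2) with hκdef
  have hκ : 0 < κ := lt_min hδ (by norm_num)
  have hκ1 : κ < 1 := (min_le_right _ _).trans_lt (by norm_num)
  have hκδ : κ ≤ δ := min_le_left _ _
  have hv := tendsto_aggregatedVariance hδ hf
  have hexp : Tendsto (fun n => Real.exp (-(aggregatedVariance f n / 2))) atTop
      (𝓝 (Real.exp (-((∫ z, logIntegrand f f z ∂quadrantMeasure) / 2)))) :=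
    (Real.continuous_exp.tendsto _).comp ((hv.div_const 2).neg)
  have hinv : Tendsto (fun n : ℕ => (n : ℝ) / m n) atTop (𝓝 0) := by
    refine hm.inv_tendsto_atTop.congr fun n => ?_
    simp
  -- Divergence of `m n / n` excludes `m n = 0` eventually, since the ratio would then be `0`.
  have hpos : ∀ᶠ n : ℕ in atTop, 0 < m n := by
    filter_upwards [hm.eventually_gt_atTop 0] with n hn
    rcases Nat.eq_zero_or_pos (m n) with h0 | h0
    · simp [h0] at hn
    · exact h0
  have hminv : Tendsto (fun n : ℕ => ((m n : ℝ))⁻¹) atTop (𝓝 0) := by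
    refine tendsto_of_tendsto_of_tendsto_of_le_of_le' tendsto_const_nhds hinv
      (Eventually.of_forall fun n => by positivity) ?_
    filter_upwards [eventually_ge_atTop 1] with n hn
    rw [div_eq_mul_inv]
    exact le_mul_of_one_le_left (by positivity) (by exact_mod_cast hn)
  have hbound : Tendsto (fun n : ℕ => layerConstant κ f * ((n : ℝ) / m n) ^ κ
      + (aggregatedVariance f n / 2) ^ 2 / m n) atTop (𝓝 0) := by
    have h1 := (hinv.rpow_const (p := κ) (Or.inr hκ.le)).const_mul (layerConstant κ f)
    have h2 := ((hv.div_const 2).pow 2).mul hminv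
    rw [Real.zero_rpow hκ.ne', mul_zero] at h1
    rw [mul_zero] at h2
    simpa [div_eq_mul_inv] using h1.add h2
  have hdiff := squeeze_zero_norm' (f := fun n : ℕ => ∏ i ∈ Finset.range (m n),
        ∫ ω, Real.exp (-(layerWeight f n (layerData (q i) (η i) ω) ^ 2 / (2 * m n))) ∂P
        - Real.exp (-(aggregatedVariance f n / 2))) (by
    filter_upwards [hpos, eventually_gt_atTop 0] with n h1 h2
    exact abs_prod_laplace_sub_le h hκ hκ1 hκδ hf h2 h1) hbound
  simpa using hdiff.add hexp

end Layers

/-! ### Representation of the prelimit -/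

/-- The cell `(j/n, (j+1)/n]` is exactly the set where `⌈nt⌉ = j+1`, so the terms are the integrals
of one integrable function over a partition of the half-line. -/
theorem hasSum_mul_cell_integral {c : ℕ → ℝ} {C : ℝ} (hc : ∀ j, |c j| ≤ C) {f : ℝ → ℝ}
    (hf : Integrable f halfLine) {n : ℕ} (hn : 0 < n) :
    HasSum (fun j : ℕ => c (j + 1) * ∫ x in ((j : ℝ) / n)..(((j : ℝ) + 1) / n), f x)
      (∫ t, c ⌈(n : ℝ) * t⌉₊ * f t ∂halfLine) := by
  have hn0 : (0 : ℝ) < n := by exact_mod_cast hn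
  set s : ℕ → Set ℝ := fun j => Set.Ioc ((j : ℝ) / n) (((j : ℝ) + 1) / n) with hs
  have hmem : ∀ j t, t ∈ s j ↔ 0 < t ∧ ⌈(n : ℝ) * t⌉₊ = j + 1 := by
    intro j t
    rw [hs, Set.mem_Ioc, div_lt_iff₀ hn0, le_div_iff₀ hn0, mul_comm t,
      Nat.ceil_eq_iff (Nat.succ_ne_zero j)]
    push_cast
    constructor
    · rintro ⟨h1, h2⟩
      exact ⟨(mul_pos_iff_of_pos_left hn0).1 ((Nat.cast_nonneg j).trans_lt h1), h1, h2⟩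
    · rintro ⟨-, h1, h2⟩
      exact ⟨h1, h2⟩
  have hU : ⋃ j, s j = Set.Ioi (0 : ℝ) := by
    ext t
    simp only [Set.mem_iUnion, hmem, Set.mem_Ioi]
    constructor
    · rintro ⟨j, h, -⟩
      exact h
    · intro h
      refine ⟨⌈(n : ℝ) * t⌉₊ - 1, h, ?_⟩
      have : 0 < ⌈(n : ℝ) * t⌉₊ := Nat.ceil_pos.2 (mul_pos hn0 h)
      omega
  have hd : Pairwise (Function.onFun Disjoint s) := by
    intro i j hij
    rw [Function.onFun, Set.disjoint_left]
    intro t hi hj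
    have h1 := ((hmem i t).1 hi).2
    have h2 := ((hmem j t).1 hj).2
    omega
  have hcm : Measurable fun t : ℝ => c ⌈(n : ℝ) * t⌉₊ :=
    (measurable_of_countable c).comp (by fun_prop : Measurable fun t : ℝ => ⌈(n : ℝ) * t⌉₊)
  have hfi : IntegrableOn (fun t => c ⌈(n : ℝ) * t⌉₊ * f t) (⋃ j, s j) volume := by
    rw [hU]
    exact integrable_kernel_section hcm (fun t => hc _) hf
  have h := hasSum_integral_iUnion (fun j => measurableSet_Ioc) hd hfi
  rw [hU] at h
  have hcell : ∀ j : ℕ, c (j + 1) * ∫ x in ((j : ℝ) / n)..(((j : ℝ) + 1) / n), f x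
      = ∫ t in s j, c ⌈(n : ℝ) * t⌉₊ * f t := by
    intro j
    have hle : (j : ℝ) / n ≤ ((j : ℝ) + 1) / n := by gcongr; linarith
    rw [intervalIntegral.integral_of_le hle, ← integral_const_mul]
    refine setIntegral_congr_fun measurableSet_Ioc fun t ht => ?_
    have hceil := ((hmem j t).1 ht).2
    simp only [hceil]
  simp_rw [hcell]
  exact h

theorem signProd_range (η : ℕ → Bool) (j : ℕ) :
    signProd η (Finset.range j) = (-1) ^ (∑ k ∈ Finset.range j, (η k).toNat) := by
  rw [← Finset.prod_pow_eq_pow_sum, signProd]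
  refine Finset.prod_congr rfl fun k _ => ?_
  cases η k <;> simp

/-- A failure leaves the sign unchanged and a success flips it; this is the telescoping identity
behind the representation of `G_n(f)`. -/
theorem signedStep_eq {Ω : Type*} (η : ℕ → Ω → Bool) (k : ℕ) (ω : Ω) :
    signedStep η k ω = (signProd (fun l => η l ω) (Finset.range k)
      - signProd (fun l => η l ω) (Finset.range (k + 1))) / 2 := by
  rw [signProd_range, signProd_range, signedStep, bernoulliCount, Finset.sum_range_succ]
  cases η k ω
  · simp
  · simp only [Bool.toNat_true, Nat.cast_one, pow_add, pow_one]
    ring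

section Representation

variable {Ω : Type*} [MeasurableSpace Ω] {P : Measure Ω} {X q : ℕ → Ω → ℝ} {η : ℕ → ℕ → Ω → Bool}

/-- The contribution of the `i`-th layer to `√m_n G_n(f)`. -/
def layerTerm (X q : ℕ → Ω → ℝ) (η : ℕ → ℕ → Ω → Bool) (f : ℝ → ℝ) (n i : ℕ) (ω : Ω) : ℝ :=
  X i ω * layerWeight f n (layerData (q i) (η i) ω)

/-- At `n = 0` division by zero returns `0`, so every cell degenerates to a point. -/
theorem aggregatedTerm_zero (m : ℕ) (f : ℝ → ℝ) (j : ℕ) (ω : Ω) :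
    aggregatedTerm X q η P m 0 f j ω = 0 := by
  simp [aggregatedTerm]

theorem IsLayerModel.measurable_layerTerm (h : IsLayerModel X q η P) {f : ℝ → ℝ}
    (hf : AEStronglyMeasurable f halfLine) (n i : ℕ) : Measurable (layerTerm X q η f n i) :=
  (h.measurable_X i).mul ((measurable_layerWeight hf n).comp
    (h.isBernoulliLayer i).measurable_layerData)

variable [IsProbabilityMeasure P]

theorem IsBernoulliLayer.condExp_signedStep {q : Ω → ℝ} {η : ℕ → Ω → Bool}
    (h : IsBernoulliLayer q η P) (k : ℕ) :
    P[signedStep η k | MeasurableSpace.comap q inferInstance]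
      =ᵐ[P] fun ω => ((1 - 2 * q ω) ^ k - (1 - 2 * q ω) ^ (k + 1)) / 2 := by
  have heq : signedStep η k = (1 / 2 : ℝ) • ((fun ω => signProd (fun l => η l ω) (Finset.range k))
      - fun ω => signProd (fun l => η l ω) (Finset.range (k + 1))) := by
    funext ω
    rw [signedStep_eq]
    simp only [Pi.smul_apply, Pi.sub_apply, smul_eq_mul]
    ring
  rw [heq]
  filter_upwards [condExp_smul (1 / 2 : ℝ) ((fun ω => signProd (fun l => η l ω) (Finset.range k))
      - fun ω => signProd (fun l => η l ω) (Finset.range (k + 1)))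
      (MeasurableSpace.comap q inferInstance),
    condExp_sub (h.integrable_signProd (Finset.range k))
      (h.integrable_signProd (Finset.range (k + 1))) (MeasurableSpace.comap q inferInstance),
    h.condExp_signProd (Finset.range k), h.condExp_signProd (Finset.range (k + 1))]
    with ω e1 e2 e3 e4
  rw [e1, Pi.smul_apply, e2, Pi.sub_apply, e3, e4, Finset.card_range, Finset.card_range,
    smul_eq_mul]
  ring

/-- The steps and their conditional means telescope together, from the common value `1` at `j = 0`.
One null set serves all `j`. -/
theorem IsBernoulliLayer.sum_layerStep {q : Ω → ℝ} {η : ℕ → Ω → Bool}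
    (h : IsBernoulliLayer q η P) (X : Ω → ℝ) : ∀ᵐ ω ∂P, ∀ j,
    ∑ k ∈ Finset.range j, layerStep X q η P k ω
      = X ω / Real.sqrt (q ω) * (centeredSign j (layerData q η ω) / 2) := by
  have hall := ae_all_iff.2 fun k => h.condExp_signedStep k
  filter_upwards [hall] with ω hω j
  induction j with
  | zero => simp [centeredSign, signProd]
  | succ j ih =>
    rw [Finset.sum_range_succ, ih, layerStep, hω j, signedStep_eq]
    simp only [centeredSign, layerData]
    ring

/-- The null set is independent of `f`, which later yields linearity in `f` outside a single null
set. The factor `1/2` comes from the centered signs and cancels the `2` in `G_n(f)`. -/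
theorem IsLayerModel.hasSum_aggregatedTerm (h : IsLayerModel X q η P) (m : ℕ) {n : ℕ}
    (hn : 0 < n) : ∀ᵐ ω ∂P, ∀ f : ℝ → ℝ, Integrable f halfLine →
    HasSum (fun j => aggregatedTerm X q η P m n f j ω)
      ((Real.sqrt m)⁻¹ * (∑ i ∈ Finset.range m, layerTerm X q η f n i ω) / 2) := by
  have h1 := ae_all_iff.2 fun i => (h.isBernoulliLayer i).sum_layerStep (X i)
  have h2 := ae_all_iff.2 fun i => (h.isBernoulliLayer i).ae_mem_Ioo
  filter_upwards [h1, h2] with ω e1 e2 f hf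
  have hint : ∀ i, Integrable
      (fun t : ℝ => centeredSign ⌈(n : ℝ) * t⌉₊ (layerData (q i) (η i) ω) * f t) halfLine := by
    intro i
    have hm : Measurable fun t : ℝ => centeredSign ⌈(n : ℝ) * t⌉₊ (layerData (q i) (η i) ω) :=
      (measurable_of_countable fun j : ℕ => centeredSign j (layerData (q i) (η i) ω)).comp
        (by fun_prop : Measurable fun t : ℝ => ⌈(n : ℝ) * t⌉₊)
    exact integrable_kernel_section hm
      (fun t => abs_centeredSign_le (d := layerData (q i) (η i) ω) (e2 i) _) hf
  set c : ℕ → ℝ := fun j => partialSum X q η P m j ω with hcdef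
  have hc : ∀ j, c j = (Real.sqrt m)⁻¹ * ∑ i ∈ Finset.range m,
      X i ω / Real.sqrt (q i ω) * (centeredSign j (layerData (q i) (η i) ω) / 2) := by
    intro j
    simp only [hcdef, partialSum]
    rw [Finset.sum_congr rfl fun i _ => e1 i j]
  have hbound : ∀ j, |c j| ≤ (Real.sqrt m)⁻¹ * ∑ i ∈ Finset.range m,
      |X i ω / Real.sqrt (q i ω)| := by
    intro j
    rw [hc, abs_mul, abs_of_nonneg (by positivity : 0 ≤ (Real.sqrt m)⁻¹)]
    gcongr
    refine (Finset.abs_sum_le_sum_abs _ _).trans (Finset.sum_le_sum fun i _ => ?_)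
    rw [abs_mul]
    refine mul_le_of_le_one_right (abs_nonneg _) ?_
    rw [abs_div, abs_two, div_le_one two_pos]
    exact abs_centeredSign_le (d := layerData (q i) (η i) ω) (e2 i) j
  have hsum := hasSum_mul_cell_integral hbound hf hn
  have hval : ∫ t, c ⌈(n : ℝ) * t⌉₊ * f t ∂halfLine
      = (Real.sqrt m)⁻¹ * (∑ i ∈ Finset.range m, layerTerm X q η f n i ω) / 2 := by
    have hexp : ∀ t : ℝ, c ⌈(n : ℝ) * t⌉₊ * f t = ∑ i ∈ Finset.range m,
        (Real.sqrt m)⁻¹ * (X i ω / Real.sqrt (q i ω) / 2) *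
          (centeredSign ⌈(n : ℝ) * t⌉₊ (layerData (q i) (η i) ω) * f t) := by
      intro t
      rw [hc, Finset.mul_sum, Finset.sum_mul]
      exact Finset.sum_congr rfl fun i _ => by ring
    simp_rw [hexp]
    rw [integral_finsetSum _ fun i _ => (hint i).const_mul _, Finset.mul_sum, Finset.sum_div]
    refine Finset.sum_congr rfl fun i _ => ?_
    rw [integral_const_mul, layerTerm, layerWeight, signIntegral, layerData]
    ring
  rw [← hval]
  exact hsum

theorem IsLayerModel.aggregated_eq (h : IsLayerModel X q η P) (m : ℕ) {n : ℕ}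
    (hn : 0 < n) : ∀ᵐ ω ∂P, ∀ f : ℝ → ℝ, Integrable f halfLine →
    aggregated X q η P m n f ω
      = (Real.sqrt m)⁻¹ * ∑ i ∈ Finset.range m, layerTerm X q η f n i ω := by
  filter_upwards [h.hasSum_aggregatedTerm m hn] with ω hω f hf
  rw [aggregated, (hω f hf).tsum_eq]
  ring

/-- For real series summability is absolute convergence. -/
theorem IsLayerModel.ae_summable (h : IsLayerModel X q η P) (m n : ℕ) {f : ℝ → ℝ}
    (hf : Integrable f halfLine) :
    ∀ᵐ ω ∂P, Summable fun j => aggregatedTerm X q η P m n f j ω := by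
  rcases Nat.eq_zero_or_pos n with rfl | hn
  · exact ae_of_all _ fun ω => by simp only [aggregatedTerm_zero, summable_zero]
  · filter_upwards [h.hasSum_aggregatedTerm m hn] with ω hω
    exact (hω f hf).summable

theorem IsLayerModel.aemeasurable_aggregated (h : IsLayerModel X q η P) (m n : ℕ) {f : ℝ → ℝ}
    (hf : Integrable f halfLine) : AEMeasurable (aggregated X q η P m n f) P := by
  rcases Nat.eq_zero_or_pos n with rfl | hn
  · have : aggregated X q η P m 0 f = fun _ => 0 := by
      funext ω
      simp [aggregated, aggregatedTerm_zero]
    rw [this]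
    exact aemeasurable_const
  · refine AEMeasurable.congr (f := fun ω => (Real.sqrt m)⁻¹ *
      ∑ i ∈ Finset.range m, layerTerm X q η f n i ω) ?_ ?_
    · exact ((Finset.measurable_sum _ fun i _ =>
        h.measurable_layerTerm hf.aestronglyMeasurable n i).const_mul _).aemeasurable
    · filter_upwards [h.aggregated_eq m hn] with ω hω using (hω f hf).symm

/-! ### The characteristic function of the prelimit -/

/-- By independence the joint law is a product; integrating the Gaussian variable first leaves its
characteristic function evaluated at `tY`. -/
theorem charFun_map_gaussian_mul {Z Y : Ω → ℝ} (hZ : Measurable Z) (hY : Measurable Y)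
    (hlaw : HasLaw Z (gaussianReal 0 1) P) (hind : IndepFun Z Y P) (t : ℝ) :
    charFun (P.map fun ω => Z ω * Y ω) t = ((∫ ω, Real.exp (-((t * Y ω) ^ 2 / 2)) ∂P : ℝ) : ℂ) := by
  have hmap : P.map (fun ω => (Z ω, Y ω)) = (gaussianReal 0 1).prod (P.map Y) := by
    rw [(indepFun_iff_map_prod_eq_prod_map_map hZ.aemeasurable hY.aemeasurable).1 hind,
      hlaw.map_eq]
  have : IsProbabilityMeasure (P.map Y) := Measure.isProbabilityMeasure_map hY.aemeasurable
  have hcont : Continuous fun p : ℝ × ℝ => Complex.exp (t * ((p.1 * p.2 : ℝ) : ℂ) * Complex.I) := by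
    fun_prop
  have hnorm : ∀ p : ℝ × ℝ, ‖Complex.exp (t * ((p.1 * p.2 : ℝ) : ℂ) * Complex.I)‖ ≤ 1 := by
    intro p
    rw [← Complex.ofReal_mul, Complex.norm_exp_ofReal_mul_I]
  have hint : Integrable (fun p : ℝ × ℝ => Complex.exp (t * ((p.1 * p.2 : ℝ) : ℂ) * Complex.I))
      ((gaussianReal 0 1).prod (P.map Y)) :=
    Integrable.of_bound hcont.aestronglyMeasurable 1 (ae_of_all _ hnorm)
  rw [charFun_apply_real, integral_map (by fun_prop : Measurable fun ω => Z ω * Y ω).aemeasurable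
    (by fun_prop)]
  have h1 : ∫ ω, Complex.exp (t * ((Z ω * Y ω : ℝ) : ℂ) * Complex.I) ∂P
      = ∫ p, Complex.exp (t * ((p.1 * p.2 : ℝ) : ℂ) * Complex.I) ∂(P.map fun ω => (Z ω, Y ω)) := by
    rw [integral_map (hZ.prodMk hY).aemeasurable hcont.aestronglyMeasurable]
  have h2 : ∀ y : ℝ, ∫ x, Complex.exp (t * ((x * y : ℝ) : ℂ) * Complex.I) ∂(gaussianReal 0 1)
      = ((Real.exp (-((t * y) ^ 2 / 2)) : ℝ) : ℂ) := by
    intro y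
    have h3 := charFun_gaussianReal (μ := 0) (v := 1) (t * y)
    rw [charFun_apply_real] at h3
    have h4 : ∀ x : ℝ, Complex.exp (t * ((x * y : ℝ) : ℂ) * Complex.I)
        = Complex.exp (((t * y : ℝ) : ℂ) * x * Complex.I) := by
      intro x
      congr 1
      push_cast
      ring
    simp_rw [h4]
    rw [h3]
    push_cast
    congr 1
    ring
  rw [h1, hmap, integral_prod_symm _ hint]
  simp only [h2]
  rw [integral_complex_ofReal, integral_map hY.aemeasurable (by fun_prop)]

/-- The value is the characteristic function of a sum of independent layers at frequency `m^{-1/2}`.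
The Gaussian multipliers turn each factor into a real Laplace transform of a squared layer weight.
-/
theorem IsLayerModel.integral_exp_aggregated (h : IsLayerModel X q η P) (m : ℕ) {n : ℕ}
    (hn : 0 < n) {f : ℝ → ℝ} (hf : Integrable f halfLine) :
    ∫ ω, Complex.exp (Complex.I * (aggregated X q η P m n f ω : ℂ)) ∂P
      = ((∏ i ∈ Finset.range m, ∫ ω, Real.exp
        (-(layerWeight f n (layerData (q i) (η i) ω) ^ 2 / (2 * m))) ∂P : ℝ) : ℂ) := by
  have hmeas := fun i => h.measurable_layerTerm hf.aestronglyMeasurable n i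
  have hw := measurable_layerWeight hf.aestronglyMeasurable n
  have hind : iIndepFun (layerTerm X q η f n) P :=
    h.indep.comp (fun _ (p : ℝ × (ℝ × (ℕ → Bool))) => p.1 * layerWeight f n p.2)
      (fun _ => measurable_fst.mul (hw.comp measurable_snd))
  have h1 : ∫ ω, Complex.exp (Complex.I * (aggregated X q η P m n f ω : ℂ)) ∂P
      = charFun (P.map fun ω => ∑ i ∈ Finset.range m, layerTerm X q η f n i ω)
        (Real.sqrt m)⁻¹ := by
    rw [charFun_apply_real, integral_map
      (Finset.measurable_sum _ fun i _ => hmeas i).aemeasurable (by fun_prop)]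
    refine integral_congr_ae ?_
    filter_upwards [h.aggregated_eq m hn] with ω hω
    rw [hω f hf]
    congr 1
    push_cast
    ring
  rw [h1, iIndepFun.charFun_map_fun_finsetSum_eq_prod (fun i _ => (hmeas i).aemeasurable)
    (hind.restrict _), Finset.prod_apply, Complex.ofReal_prod]
  refine Finset.prod_congr rfl fun i _ => ?_
  have hD := (h.isBernoulliLayer i).measurable_layerData
  have hI : IndepFun (X i) (fun ω => layerWeight f n (layerData (q i) (η i) ω)) P :=
    (h.indep_layer i).comp measurable_id hw
  have h2 := charFun_map_gaussian_mul (h.measurable_X i) (hw.comp hD) (h.gaussian_X i) hI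
    (Real.sqrt m)⁻¹
  refine h2.trans ?_
  congr 1
  refine integral_congr_ae (ae_of_all _ fun ω => ?_)
  simp only [Function.comp_apply]
  congr 2
  rw [mul_pow, inv_pow, Real.sq_sqrt (Nat.cast_nonneg m)]
  rw [div_eq_mul_inv, div_eq_mul_inv, mul_inv]
  ring

end Representation

/-! ### Linear combinations -/

section LinearCombination

variable {δ : ℝ} {k : ℕ} {F : Fin k → ℝ → ℝ}

theorem signIntegral_sum (hF : ∀ l, Integrable (F l) halfLine) (c : Fin k → ℝ) (n : ℕ)
    {d : ℝ × (ℕ → Bool)} (hd : d.1 ∈ Set.Ioo (0 : ℝ) 1) :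
    signIntegral (fun t => ∑ l, c l * F l t) n d = ∑ l, c l * signIntegral (F l) n d := by
  have hm : Measurable fun t : ℝ => centeredSign ⌈(n : ℝ) * t⌉₊ d :=
    (measurable_of_countable fun j : ℕ => centeredSign j d).comp
      (by fun_prop : Measurable fun t : ℝ => ⌈(n : ℝ) * t⌉₊)
  have hint := fun l => integrable_kernel_section hm (fun t => abs_centeredSign_le hd _) (hF l)
  simp only [signIntegral]
  have hexp : ∀ t : ℝ, centeredSign ⌈(n : ℝ) * t⌉₊ d * ∑ l, c l * F l t
      = ∑ l, c l * (centeredSign ⌈(n : ℝ) * t⌉₊ d * F l t) := by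
    intro t
    rw [Finset.mul_sum]
    exact Finset.sum_congr rfl fun l _ => by ring
  simp_rw [hexp]
  rw [integral_finsetSum _ fun l _ => (hint l).const_mul _]
  simp_rw [integral_const_mul]

theorem IsLayerModel.aggregated_sum {Ω : Type*} [MeasurableSpace Ω] {P : Measure Ω}
    [IsProbabilityMeasure P] {X q : ℕ → Ω → ℝ} {η : ℕ → ℕ → Ω → Bool} (h : IsLayerModel X q η P)
    (hF : ∀ l, Integrable (F l) halfLine) (c : Fin k → ℝ) (m : ℕ) {n : ℕ} (hn : 0 < n) :
    ∀ᵐ ω ∂P, aggregated X q η P m n (fun t => ∑ l, c l * F l t) ω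
      = ∑ l, c l * aggregated X q η P m n (F l) ω := by
  have h2 := ae_all_iff.2 fun i => (h.isBernoulliLayer i).ae_mem_Ioo
  have hsum : Integrable (fun t => ∑ l, c l * F l t) halfLine :=
    integrable_finsetSum _ fun l _ => (hF l).const_mul _
  filter_upwards [h.aggregated_eq m hn, h2] with ω hω hq
  simp only [hω _ hsum, fun l => hω _ (hF l), Finset.mul_sum]
  rw [Finset.sum_comm]
  refine Finset.sum_congr rfl fun i _ => ?_
  rw [layerTerm, layerWeight, signIntegral_sum hF c n (d := layerData (q i) (η i) ω) (hq i)]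
  simp only [Finset.mul_sum, layerTerm, layerWeight]
  exact Finset.sum_congr rfl fun l _ => by ring

theorem integral_logIntegrand_sum (hδ : 0 < δ) (hF : ∀ l, F l ∈ TestClass δ) (c : Fin k → ℝ) :
    ∫ z, logIntegrand (fun t => ∑ l, c l * F l t) (fun t => ∑ l, c l * F l t) z ∂quadrantMeasure
      = ∑ l, ∑ l', c l * c l' * ∫ z, logIntegrand (F l) (F l') z ∂quadrantMeasure := by
  have hexp : ∀ z, logIntegrand (fun t => ∑ l, c l * F l t) (fun t => ∑ l, c l * F l t) z
      = ∑ l, ∑ l', c l * c l' * logIntegrand (F l) (F l') z := by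
    intro z
    simp only [logIntegrand]
    rw [Finset.sum_mul_sum, Finset.sum_mul]
    refine Finset.sum_congr rfl fun l _ => ?_
    rw [Finset.sum_mul]
    exact Finset.sum_congr rfl fun l' _ => by ring
  have hi := fun l l' => (integrable_logIntegrand hδ (hF l) (hF l')).const_mul (c l * c l')
  simp_rw [hexp]
  rw [integral_finsetSum _ fun l _ => integrable_finsetSum _ fun l' _ => hi l l']
  refine Finset.sum_congr rfl fun l _ => ?_
  rw [integral_finsetSum _ fun l' _ => hi l l']
  simp_rw [integral_const_mul]

end LinearCombination

/-! ### Characteristic functions -/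

theorem HasGaussianLaw.integral_exp_I_mul {Ω : Type*} [MeasurableSpace Ω] {Q : Measure Ω}
    [IsProbabilityMeasure Q] {Y : Ω → ℝ} (hY : HasGaussianLaw Y Q) (h0 : ∫ ω, Y ω ∂Q = 0) :
    ∫ ω, Complex.exp (Complex.I * (Y ω : ℂ)) ∂Q = (Real.exp (-(1 / 2) * Var[Y; Q]) : ℂ) := by
  have h := hY.charFun_map_eq 1
  rw [charFun_apply_real, integral_map hY.aemeasurable (by fun_prop)] at h
  simp only [Complex.ofReal_one, one_mul, RCLike.inner_apply, conj_trivial, mul_one, h0,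
    Complex.ofReal_zero, zero_mul, zero_sub] at h
  simp_rw [mul_comm Complex.I]
  rw [h]
  push_cast
  congr 1
  ring


/-- The Cramér–Wold device combined with Lévy's continuity theorem. -/
theorem tendstoInDistribution_pi_of_tendsto_integral_exp {Ω Ω₁ : Type*} [MeasurableSpace Ω]
    [MeasurableSpace Ω₁] {P : Measure Ω} [IsProbabilityMeasure P] {Q : Measure Ω₁}
    [IsProbabilityMeasure Q] {k : ℕ} {Y : ℕ → Ω → Fin k → ℝ} {Z : Ω₁ → Fin k → ℝ}
    (hY : ∀ n l, AEMeasurable (fun ω => Y n ω l) P) (hZ : ∀ l, AEMeasurable (fun ω => Z ω l) Q)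
    (h : ∀ c : Fin k → ℝ, Tendsto
      (fun n => ∫ ω, Complex.exp (Complex.I * (∑ l, c l * Y n ω l : ℝ)) ∂P) atTop
      (𝓝 (∫ ω, Complex.exp (Complex.I * (∑ l, c l * Z ω l : ℝ)) ∂Q))) :
    TendstoInDistribution Y atTop Z (fun _ => P) Q := by
  -- Characteristic functions are taken in Euclidean space, where the frequency is a vector paired
  -- by the inner product; the continuous identification carries the convergence back to `Fin k →
  -- ℝ`.
  have hlp : Continuous (WithLp.toLp 2 : (Fin k → ℝ) → EuclideanSpace ℝ (Fin k)) :=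
    PiLp.continuous_toLp 2 _
  have hY' := fun n => hlp.measurable.comp_aemeasurable (aemeasurable_pi_lambda _ (hY n))
  have hZ' := hlp.measurable.comp_aemeasurable (aemeasurable_pi_lambda _ hZ)
  have key : TendstoInDistribution (fun n ω => (WithLp.toLp 2 (Y n ω) : EuclideanSpace ℝ (Fin k)))
      atTop (fun ω => (WithLp.toLp 2 (Z ω) : EuclideanSpace ℝ (Fin k))) (fun _ => P) Q := by
    refine ⟨hY', hZ', ProbabilityMeasure.tendsto_of_tendsto_charFun fun t => ?_⟩
    simp only [ProbabilityMeasure.coe_mk, charFun_apply]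
    have hc : Continuous fun x : EuclideanSpace ℝ (Fin k) =>
        Complex.exp ((inner ℝ x t : ℝ) * Complex.I) := by fun_prop
    have hin : ∀ x : EuclideanSpace ℝ (Fin k), inner ℝ x t = ∑ l, t l * x l := by
      intro x
      simp [PiLp.inner_apply]
    have e1 := fun n => integral_map (hY' n) hc.aestronglyMeasurable
    have e2 := integral_map hZ' hc.aestronglyMeasurable
    simp only [Function.comp_def, hin] at e1 e2 ⊢
    rw [e2]
    simp_rw [e1, mul_comm _ Complex.I]
    exact h fun l => t l
  exact key.continuous_comp (PiLp.continuous_ofLp 2 _)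

/-! ### The prelimit and the limit processes -/

section Convergence

variable {Ω : Type*} [MeasurableSpace Ω] {P : Measure Ω} [IsProbabilityMeasure P]
  {X q : ℕ → Ω → ℝ} {η : ℕ → ℕ → Ω → Bool} {m : ℕ → ℕ} {δ : ℝ} {f : ℝ → ℝ}

theorem IsLayerModel.tendsto_integral_exp_aggregated (h : IsLayerModel X q η P)
    (hm : Tendsto (fun n : ℕ => (m n : ℝ) / n) atTop atTop) (hδ : 0 < δ) (hf : f ∈ TestClass δ) :
    Tendsto (fun n : ℕ =>
        ∫ ω, Complex.exp (Complex.I * (aggregated X q η P (m n) n f ω : ℂ)) ∂P) atTop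
      (𝓝 (Real.exp (-((∫ z, logIntegrand f f z ∂quadrantMeasure) / 2)) : ℂ)) := by
  have hlim := (Complex.continuous_ofReal.tendsto _).comp
    (tendsto_prod_laplace h.isBernoulliLayer hδ hf hm)
  refine hlim.congr' ?_
  filter_upwards [eventually_gt_atTop 0] with n hn
  exact (h.integral_exp_aggregated (m n) hn (TestClass.integrable hδ.le hf)).symm

variable {Ω' Ω₁ : Type*} [MeasurableSpace Ω'] [MeasurableSpace Ω₁] {P' : Measure Ω'}
  [IsProbabilityMeasure P'] {N : ℝ≥0 → Ω' → ℕ} {Q : Measure Ω₁} [IsProbabilityMeasure Q]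
  {I : (ℝ × Ω' → ℝ) → Ω₁ → ℝ}

/-- A linear combination of the limit variables is centered Gaussian. By bilinearity its variance is
the logarithmic form evaluated at the same combination of test functions, matching the limit of
`G_n` at that combination. -/
theorem IsGaussianIntegral.integral_exp_sum_limitProcess
    (hI : IsGaussianIntegral I (controlMeasure P') Q) (hN : IsStandardPoisson N P') (hδ : 0 < δ)
    {k : ℕ} {F : Fin k → ℝ → ℝ} (hF : ∀ l, F l ∈ TestClass δ) (c : Fin k → ℝ) :
    ∫ ω, Complex.exp (Complex.I * (∑ l, c l * limitProcess N P' I (F l) ω : ℝ)) ∂Q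
      = (Real.exp (-((∫ z, logIntegrand (fun t => ∑ l, c l * F l t) (fun t => ∑ l, c l * F l t) z
          ∂quadrantMeasure) / 2)) : ℂ) := by
  have hG := ((hI.isGaussianProcess_limitProcess hN hδ).comp_right
    fun l : Fin k => (⟨F l, hF l⟩ : TestClass δ))
  have hL : HasGaussianLaw (fun ω => ∑ l, c l * limitProcess N P' I (F l) ω) Q :=
    (hG.smul c).hasGaussianLaw_fun_sum (I := Finset.univ)
  have h2 : ∀ l, MemLp (limitProcess N P' I (F l)) 2 Q := fun l =>
    (hG.hasGaussianLaw_eval l).memLp_two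
  have h2c : ∀ l, MemLp (fun ω => c l * limitProcess N P' I (F l) ω) 2 Q := fun l =>
    (h2 l).const_mul _
  have h0 : ∫ ω, ∑ l, c l * limitProcess N P' I (F l) ω ∂Q = 0 := by
    rw [integral_finsetSum _ fun l _ => (h2c l).integrable (by norm_num)]
    refine Finset.sum_eq_zero fun l _ => ?_
    rw [integral_const_mul, limitProcess, hI.centered _ (hN.memLp_oddKernel hδ (hF l)), mul_zero]
  rw [HasGaussianLaw.integral_exp_I_mul hL h0, variance_fun_sum h2c,
    integral_logIntegrand_sum hδ hF c]
  simp_rw [covariance_const_mul_left, covariance_const_mul_right,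
    hI.covariance_limitProcess hN hδ (hF _) (hF _), ← mul_assoc]
  congr 2
  ring

theorem IsGaussianIntegral.integral_exp_limitProcess
    (hI : IsGaussianIntegral I (controlMeasure P') Q) (hN : IsStandardPoisson N P') (hδ : 0 < δ)
    (hf : f ∈ TestClass δ) :
    ∫ ω, Complex.exp (Complex.I * (limitProcess N P' I f ω : ℂ)) ∂Q
      = (Real.exp (-((∫ z, logIntegrand f f z ∂quadrantMeasure) / 2)) : ℂ) := by
  simpa using hI.integral_exp_sum_limitProcess hN hδ (F := fun _ : Fin 1 => f) (fun _ => hf)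
    fun _ => 1

end Convergence

end

/-! ### The theorem -/

theorem theorem2p1
    -- the aggregated model
    {Ω : Type*} [MeasurableSpace Ω] (P : Measure Ω) [IsProbabilityMeasure P]
    (X q : ℕ → Ω → ℝ) (η : ℕ → ℕ → Ω → Bool) (hmodel : IsLayerModel X q η P)
    -- the number of layers
    (m : ℕ → ℕ) (hm : Tendsto (fun n : ℕ => (m n : ℝ) / n) atTop atTop)
    -- the Poisson process and the Gaussian random measure driving the limit process
    {Ω' : Type*} [MeasurableSpace Ω'] (P' : Measure Ω') [IsProbabilityMeasure P']
    (N : ℝ≥0 → Ω' → ℕ) (hN : IsStandardPoisson N P')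
    {Ω₁ : Type*} [MeasurableSpace Ω₁] (Q : Measure Ω₁) [IsProbabilityMeasure Q]
    (I : (ℝ × Ω' → ℝ) → Ω₁ → ℝ) (hI : IsGaussianIntegral I (controlMeasure P') Q)
    (δ : ℝ) (hδ : 0 < δ) :
    -- the limit process is well defined: a centered Gaussian family with logarithmic covariance
    (∀ f ∈ TestClass δ, MemLp (oddKernel N P' f) 2 (controlMeasure P')) ∧
    IsGaussianProcess (fun f : TestClass δ => limitProcess N P' I f.1) Q ∧
    (∀ f ∈ TestClass δ, ∫ ω, limitProcess N P' I f ω ∂Q = 0) ∧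
    (∀ f ∈ TestClass δ, ∀ g ∈ TestClass δ,
      Integrable (logIntegrand f g) quadrantMeasure ∧
      cov[limitProcess N P' I f, limitProcess N P' I g; Q]
        = ∫ z, logIntegrand f g z ∂quadrantMeasure) ∧
    -- the series defining the prelimit converges absolutely, almost surely
    (∀ f ∈ TestClass δ, ∀ n : ℕ, ∀ᵐ ω ∂P,
      Summable fun j => aggregatedTerm X q η P (m n) n f j ω) ∧
    -- convergence of characteristic functions
    (∀ f ∈ TestClass δ,
      Tendsto (fun n : ℕ =>
          ∫ ω, Complex.exp (Complex.I * (aggregated X q η P (m n) n f ω : ℂ)) ∂P) atTop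
        (𝓝 (∫ ω, Complex.exp (Complex.I * (limitProcess N P' I f ω : ℂ)) ∂Q)) ∧
      ∫ ω, Complex.exp (Complex.I * (limitProcess N P' I f ω : ℂ)) ∂Q
        = (Real.exp (-(1 / 2) * cov[limitProcess N P' I f, limitProcess N P' I f; Q]) : ℂ)) ∧
    -- convergence of the finite-dimensional distributions
    (∀ (k : ℕ) (f : Fin k → ℝ → ℝ), (∀ l, f l ∈ TestClass δ) →
      TendstoInDistribution
        (fun (n : ℕ) (ω : Ω) (l : Fin k) => aggregated X q η P (m n) n (f l) ω) atTop
        (fun (ω : Ω₁) (l : Fin k) => limitProcess N P' I (f l) ω) (fun _ => P) Q) := by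
  refine ⟨fun f hf => hN.memLp_oddKernel hδ hf, hI.isGaussianProcess_limitProcess hN hδ,
    fun f hf => hI.centered _ (hN.memLp_oddKernel hδ hf),
    fun f hf g hg => ⟨integrable_logIntegrand hδ hf hg, hI.covariance_limitProcess hN hδ hf hg⟩,
    fun f hf n => hmodel.ae_summable (m n) n (TestClass.integrable hδ.le hf), fun f hf => ?_,
    fun k f hf => ?_⟩
  · rw [hI.integral_exp_limitProcess hN hδ hf, hI.covariance_limitProcess hN hδ hf hf]
    refine ⟨hmodel.tendsto_integral_exp_aggregated hm hδ hf, ?_⟩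
    congr 2
    ring
  · refine tendstoInDistribution_pi_of_tendsto_integral_exp
      (fun n l => hmodel.aemeasurable_aggregated (m n) n (TestClass.integrable hδ.le (hf l)))
      (fun l => (hI.isGaussianProcess_limitProcess hN hδ).aemeasurable ⟨f l, hf l⟩) fun c => ?_
    rw [hI.integral_exp_sum_limitProcess hN hδ hf c]
    -- The one-function limit is applied to `∑ c_l f_l`. Linearity of `G_n` is available almost
    -- surely for `n > 0`, which is enough inside an integral and a limit.
    refine (hmodel.tendsto_integral_exp_aggregated hm hδ (TestClass.sum hf c)).congr' ?_
    filter_upwards [eventually_gt_atTop 0] with n hn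
    refine integral_congr_ae ?_
    filter_upwards [hmodel.aggregated_sum (fun l => TestClass.integrable hδ.le (hf l)) c (m n) hn]
      with ω hω
    rw [hω]
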